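/- Let $Q$ be a smooth surface homeomorphic to $\mathbb{R}^2$, with a smooth Lorentzian metric $g$ of signature $(-,+)$ and a time orientation, let $(F,h)$ be a connected smooth Riemannian manifold of dimension $n\ge 2$, and let $r:Q\to(0,\infty)$ be smooth. Let $M=Q\times F$ carry the warped product metric $\tilde g=g+r^2h$ ($g$ and $h$ being identified with their pull-backs to $M$), and let $G^{[\tilde g]}=\mathrm{Ric}_{\tilde g}-\tfrac12\,\mathrm{Scal}_{\tilde g}\,\tilde g$ be its Einstein tensor. Suppose that $(M,\tilde g)$ satisfies the dominant energy condition: $G^{[\tilde g]}(X_1,X_2)\ge 0$ for every pair of causal (i.e. nonzero, timelike or null) vectors $X_1,X_2$ at a common point of $M$ with $\tilde g(X_1,X_2)<0$. Let $\sigma:[0,1]\to Q$ be a $C^1$ spacelike curve, i.e. $g(\dot\sigma,\dot\sigma)>0$ on $[0,1]$ (one-sided derivatives at the end points). Let $L,N$ be two linearly independent future-directed null vector fields along $\sigma$, normalized such that $g(\dot\sigma,N)>0$ and $g(\dot\sigma,L)<0$ along $\sigma$. Suppose that the derivative $N(r)$ of $r$ in the direction $N$ satisfies $N(r)=0$ at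 $\sigma(0)$ and $N(r)>0$ along $\sigma((0,1])$. Then the scalar curvature of $(F,h)$ is positive everywhere on $F$: $\mathrm{Scal}_h>0$. -/

import Mathlib

open Set Bundle
open scoped Manifold ContDiff Topology

set_option maxSynthPendingDepth 3

noncomputable section

/-! ### Curvature of a metric given on (an open subset of) a vector space

Below `E` is a finite-dimensional real vector space, `G` is a field of bilinear forms on `E` (the
expression of a pseudo-Riemannian metric in a chart) and `x` is a point of `E`. -/

namespace ChartMetric

variable {E : Type*} [NormedAddCommGroup E] [NormedSpace ℝ E]

/-- Christoffel symbols of the first kind: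
`(v, w, u) ↦ (1/2) * (∂_v G(w, u) + ∂_w G(v, u) - ∂_u G(v, w))`. -/
def christoffelFirst (G : E → E →L[ℝ] E →L[ℝ] ℝ) (x : E) : E →L[ℝ] E →L[ℝ] E →L[ℝ] ℝ :=
  (2⁻¹ : ℝ) • (fderiv ℝ G x + (fderiv ℝ G x).flip -
    (ContinuousLinearMap.flipₗᵢ ℝ E E ℝ).toContinuousLinearEquiv.toContinuousLinearMap ∘L
      (fderiv ℝ G x).flip)

theorem christoffelFirst_apply (G : E → E →L[ℝ] E →L[ℝ] ℝ) (x v w u : E) :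
    christoffelFirst G x v w u =
      2⁻¹ * (fderiv ℝ G x v w u + fderiv ℝ G x w v u - fderiv ℝ G x u v w) := by
  simp [christoffelFirst]

/-- Christoffel symbols of the second kind (the Levi-Civita connection in the chart): `Γ(v, w)` is
the vector with `G(Γ(v, w), u) = christoffelFirst G x v w u` for all `u`. Here
`ContinuousLinearMap.inverse` is the true inverse of `v ↦ G(v, ·)`, since `G` is nondegenerate. -/
def christoffel (G : E → E →L[ℝ] E →L[ℝ] ℝ) (x : E) : E →L[ℝ] E →L[ℝ] E :=
  ContinuousLinearMap.compL ℝ E (E →L[ℝ] ℝ) E (G x).inverse ∘L christoffelFirst G x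

theorem christoffel_apply (G : E → E →L[ℝ] E →L[ℝ] ℝ) (x v w : E) :
    christoffel G x v w = (G x).inverse (christoffelFirst G x v w) := rfl

/-- The curvature endomorphism `u ↦ R(u, v) w`, where
`R(u, v) w = ∂_u Γ(v, w) - ∂_v Γ(u, w) + Γ(u, Γ(v, w)) - Γ(v, Γ(u, w))`. -/
def curvature (G : E → E →L[ℝ] E →L[ℝ] ℝ) (x v w : E) : E →L[ℝ] E :=
  ((fderiv ℝ (christoffel G) x).flip v).flip w - (fderiv ℝ (christoffel G) x v).flip w +
    (christoffel G x).flip (christoffel G x v w) - christoffel G x v ∘L (christoffel G x).flip w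

theorem curvature_apply (G : E → E →L[ℝ] E →L[ℝ] ℝ) (x u v w : E) :
    curvature G x v w u =
      fderiv ℝ (christoffel G) x u v w - fderiv ℝ (christoffel G) x v u w +
        christoffel G x u (christoffel G x v w) - christoffel G x v (christoffel G x u w) := rfl

/-- The Ricci tensor `Ric(v, w) = trace (u ↦ R(u, v) w)`. -/
def ricci (G : E → E →L[ℝ] E →L[ℝ] ℝ) (x : E) : E →ₗ[ℝ] E →ₗ[ℝ] ℝ :=
  LinearMap.mk₂ ℝ (fun v w => LinearMap.trace ℝ E (curvature G x v w).toLinearMap)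
    (fun v v' w => by
      rw [← map_add]; congr 1; ext u; simp [curvature]; abel)
    (fun c v w => by
      rw [← map_smul]; congr 1; ext u; simp [curvature, smul_sub, smul_add])
    (fun v w w' => by
      rw [← map_add]; congr 1; ext u; simp [curvature]; abel)
    (fun c v w => by
      rw [← map_smul]; congr 1; ext u; simp [curvature, smul_sub, smul_add])

theorem ricci_apply (G : E → E →L[ℝ] E →L[ℝ] ℝ) (x v w : E) :
    ricci G x v w = LinearMap.trace ℝ E (curvature G x v w).toLinearMap := rfl

variable [FiniteDimensional ℝ E]

/-- The scalar curvature: the trace of the endomorphism obtained from the Ricci tensor by raising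
one index with `G`. -/
def scalar (G : E → E →L[ℝ] E →L[ℝ] ℝ) (x : E) : ℝ :=
  LinearMap.trace ℝ E ((G x).inverse.toLinearMap ∘ₗ
    (LinearMap.toContinuousLinearMap : (E →ₗ[ℝ] ℝ) ≃ₗ[ℝ] (E →L[ℝ] ℝ)).toLinearMap ∘ₗ ricci G x)

/-- The Einstein tensor `Ric - (1/2) Scal G`. -/
def einstein (G : E → E →L[ℝ] E →L[ℝ] ℝ) (x v w : E) : ℝ :=
  ricci G x v w - 2⁻¹ * scalar G x * G x v w

end ChartMetric

/-! ### Curvature of a metric on a manifold without boundary -/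

section Manifold

variable {E : Type*} [NormedAddCommGroup E] [NormedSpace ℝ E]
  {H : Type*} [TopologicalSpace H] (I : ModelWithCorners ℝ E H)
  {M : Type*} [TopologicalSpace M] [ChartedSpace H M]

/-- The pull-back `(v, w) ↦ B(A v, A w)` of a bilinear form `B` under a linear map `A`. -/
def pullbackForm {V W : Type*} [AddCommGroup V] [Module ℝ V] [TopologicalSpace V]
    [AddCommGroup W] [Module ℝ W] [TopologicalSpace W]
    (B : W →L[ℝ] W →L[ℝ] ℝ) (A : V →L[ℝ] W) : V →L[ℝ] V →L[ℝ] ℝ :=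
  (ContinuousLinearMap.precomp ℝ A) ∘L B ∘L A

theorem pullbackForm_apply {V W : Type*} [AddCommGroup V] [Module ℝ V] [TopologicalSpace V]
    [AddCommGroup W] [Module ℝ W] [TopologicalSpace W]
    (B : W →L[ℝ] W →L[ℝ] ℝ) (A : V →L[ℝ] W) (v w : V) :
    pullbackForm B A v w = B (A v) (A w) := rfl

/-- The expression of a field `g` of bilinear forms on the tangent spaces in the preferred chart
at `x`, i.e. its pull-back under the inverse of this chart. -/
def metricInChart (g : ∀ x : M, TangentSpace I x →L[ℝ] TangentSpace I x →L[ℝ] ℝ) (x : M)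
    (y : E) : E →L[ℝ] E →L[ℝ] ℝ :=
  pullbackForm (g ((extChartAt I x).symm y)) (mfderiv 𝓘(ℝ, E) I (extChartAt I x).symm y)

theorem metricInChart_apply (g : ∀ x : M, TangentSpace I x →L[ℝ] TangentSpace I x →L[ℝ] ℝ)
    (x : M) (y v w : E) :
    metricInChart I g x y v w =
      g ((extChartAt I x).symm y) (mfderiv 𝓘(ℝ, E) I (extChartAt I x).symm y v)
        (mfderiv 𝓘(ℝ, E) I (extChartAt I x).symm y w) := rfl

variable [FiniteDimensional ℝ E]

/-- The scalar curvature of the pseudo-Riemannian metric `g` at `x`. -/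
def scalarCurvature (g : ∀ x : M, TangentSpace I x →L[ℝ] TangentSpace I x →L[ℝ] ℝ) (x : M) : ℝ :=
  ChartMetric.scalar (metricInChart I g x) (extChartAt I x x)

/-- The Einstein tensor of the pseudo-Riemannian metric `g` at `x`. -/
def einsteinTensor (g : ∀ x : M, TangentSpace I x →L[ℝ] TangentSpace I x →L[ℝ] ℝ) (x : M)
    (v w : TangentSpace I x) : ℝ :=
  ChartMetric.einstein (metricInChart I g x) (extChartAt I x x)
    (mfderiv I 𝓘(ℝ, E) (extChartAt I x) x v) (mfderiv I 𝓘(ℝ, E) (extChartAt I x) x w)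

/-- The dominant energy condition: the Einstein tensor is nonnegative on any two causal vectors
(at the same point) with negative scalar product. -/
def DominantEnergyCondition
    (g : ∀ x : M, TangentSpace I x →L[ℝ] TangentSpace I x →L[ℝ] ℝ) : Prop :=
  ∀ (x : M) (v w : TangentSpace I x), v ≠ 0 → w ≠ 0 → g x v v ≤ 0 → g x w w ≤ 0 → g x v w < 0 →
    0 ≤ einsteinTensor I g x v w

end Manifold

/-! ### Lorentzian metrics, time orientations, warped products -/

/-- A smooth Lorentzian metric, of signature `(-, +, …, +)`: every tangent space has a timelike
vector, and the metric is positive definite on the orthogonal complement of a timelike vector. -/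
structure LorentzianMetric {E : Type*} [NormedAddCommGroup E] [NormedSpace ℝ E]
    {H : Type*} [TopologicalSpace H] (I : ModelWithCorners ℝ E H)
    (M : Type*) [TopologicalSpace M] [ChartedSpace H M] [IsManifold I ∞ M] where
  inner (x : M) : TangentSpace I x →L[ℝ] TangentSpace I x →L[ℝ] ℝ
  symm (x : M) (v w : TangentSpace I x) : inner x v w = inner x w v
  exists_timelike (x : M) : ∃ v : TangentSpace I x, inner x v v < 0
  pos_of_orthogonal (x : M) (v w : TangentSpace I x) (hv : inner x v v < 0)
    (hvw : inner x v w = 0) (hw : w ≠ 0) : 0 < inner x w w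
  contMDiff : ContMDiff I (I.prod 𝓘(ℝ, E →L[ℝ] E →L[ℝ] ℝ)) ∞
    (fun x ↦ TotalSpace.mk' (E →L[ℝ] E →L[ℝ] ℝ) x (inner x))

/-- A time orientation of a Lorentzian manifold: a continuous timelike vector field (which is
declared to be future-directed). -/
structure TimeOrientation {E : Type*} [NormedAddCommGroup E] [NormedSpace ℝ E]
    {H : Type*} [TopologicalSpace H] {I : ModelWithCorners ℝ E H}
    {M : Type*} [TopologicalSpace M] [ChartedSpace H M] [IsManifold I ∞ M]
    (g : LorentzianMetric I M) where
  field (x : M) : TangentSpace I x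
  timelike (x : M) : g.inner x (field x) (field x) < 0
  continuous : Continuous (fun x ↦ (⟨x, field x⟩ : TangentBundle I M))

/-- A future-directed null vector. -/
def TimeOrientation.IsFutureNull {E : Type*} [NormedAddCommGroup E] [NormedSpace ℝ E]
    {H : Type*} [TopologicalSpace H] {I : ModelWithCorners ℝ E H}
    {M : Type*} [TopologicalSpace M] [ChartedSpace H M] [IsManifold I ∞ M]
    {g : LorentzianMetric I M} (T : TimeOrientation g) {x : M} (v : TangentSpace I x) : Prop :=
  v ≠ 0 ∧ g.inner x v v = 0 ∧ g.inner x (T.field x) v < 0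

/-- The warped product metric `g + r² h` on `Q × F`, where `g` and `h` are pulled back by the
projections. -/
def warpedMetric {E : Type*} [NormedAddCommGroup E] [NormedSpace ℝ E]
    {H : Type*} [TopologicalSpace H] (I : ModelWithCorners ℝ E H)
    {Q : Type*} [TopologicalSpace Q] [ChartedSpace H Q]
    {E' : Type*} [NormedAddCommGroup E'] [NormedSpace ℝ E']
    {H' : Type*} [TopologicalSpace H'] (J : ModelWithCorners ℝ E' H')
    {F : Type*} [TopologicalSpace F] [ChartedSpace H' F]
    (g : ∀ q : Q, TangentSpace I q →L[ℝ] TangentSpace I q →L[ℝ] ℝ)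
    (h : ∀ f : F, TangentSpace J f →L[ℝ] TangentSpace J f →L[ℝ] ℝ) (r : Q → ℝ) (x : Q × F) :
    TangentSpace (I.prod J) x →L[ℝ] TangentSpace (I.prod J) x →L[ℝ] ℝ :=
  pullbackForm (g x.1) (mfderiv (I.prod J) I Prod.fst x) +
    r x.1 ^ 2 • pullbackForm (h x.2) (mfderiv (I.prod J) J Prod.snd x)

/-- The velocity at time `t` of a curve defined on `[0, 1]` (one-sided at the end points). -/
def curveVelocity {E : Type*} [NormedAddCommGroup E] [NormedSpace ℝ E]
    {H : Type*} [TopologicalSpace H] (I : ModelWithCorners ℝ E H)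
    {M : Type*} [TopologicalSpace M] [ChartedSpace H M] (σ : ℝ → M) (t : ℝ) :
    TangentSpace I (σ t) :=
  mfderivWithin 𝓘(ℝ, ℝ) I σ (Icc 0 1) t (1 : ℝ)

/-- The derivative `v(f)` of a function `f` along a tangent vector `v`. -/
def dirDeriv {E : Type*} [NormedAddCommGroup E] [NormedSpace ℝ E]
    {H : Type*} [TopologicalSpace H] (I : ModelWithCorners ℝ E H)
    {M : Type*} [TopologicalSpace M] [ChartedSpace H M] (f : M → ℝ) {x : M}
    (v : TangentSpace I x) : ℝ :=
  mfderiv I 𝓘(ℝ, ℝ) f x v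

end

/-!
The argument is a Grönwall estimate for `φ = n(r)` along the curve, where `n` is a smooth null
field in the direction of `N`. Let `l` be the other future null direction. Since the curve is
spacelike and `g(σ', N) > 0`, its velocity is `a n - b l` with `a, b > 0`. In dimension two `∇n` is
proportional to `n`, whence `φ' = a Hess r(n, n) - b Hess r(l, n) + κ φ` with a locally bounded
`κ`.

The curvature of the warped product `g + r² h` with fiber dimension `m` gives

* `Ein(n, n) = -(m / r) Hess r(n, n)` (`ChartMetric.einstein_warped_null`);
* `Ein(n, l) = (m / r) Hess r(n, l) + m (m - 1) n(r) l(r) / r² - g(n, l) Scal_h / (2 r²)`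
  (`ChartMetric.einstein_warped_add`, for the sum of `Ein(n, l)` and `Ein(l, n)`).

The curvature of `g` does not enter: it contributes `K g(n, n) = 0` to the first, and the second is
`-g(n, l) / 2` times the trace of the Ricci tensor over the fiber. If `Scal_h ≤ 0` at some point of
the fiber, the dominant energy condition therefore yields `Hess r(n, n) ≤ 0` and
`r Hess r(n, l) + (m - 1) n(r) l(r) ≥ 0` (`hess_le_of_dominantEnergyCondition`). So `φ' ≤ K φ` with
a constant `K` for small times, and with `φ(0) = 0` this contradicts the positivity of `φ`
(`ChartMetric.false_of_null_deriv_pos`).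

All curvatures are computed in charts. The energy condition at a point is read in the preferred
chart at that point, while the differential inequality is derived in the chart at `σ 0`; only the
Hessian of `r` has to be compared between the two (`ChartMetric.IsMetricAt.hess_pullback`), never
the curvature.
-/

noncomputable section

/-! ### Metrics, connection and curvature in a chart -/

namespace ChartMetric

variable {E : Type*} [NormedAddCommGroup E] [NormedSpace ℝ E]

/-- `G` is a twice continuously differentiable pseudo-Riemannian metric near `x`. -/
structure IsMetricAt (G : E → E →L[ℝ] E →L[ℝ] ℝ) (x : E) : Prop where
  contDiffAt : ContDiffAt ℝ 2 G x
  symm : ∀ᶠ y in 𝓝 x, ∀ v w, G y v w = G y w v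
  isInvertible : (G x).IsInvertible

section Christoffel

variable {G G' : E → E →L[ℝ] E →L[ℝ] ℝ} {x : E}

theorem christoffelFirst_congr (h : G =ᶠ[𝓝 x] G') :
    christoffelFirst G x = christoffelFirst G' x := by
  simp only [christoffelFirst, h.fderiv_eq]

theorem christoffel_congr (h : G =ᶠ[𝓝 x] G') : christoffel G x = christoffel G' x := by
  simp only [christoffel, christoffelFirst_congr h, h.eq_of_nhds]

theorem curvature_congr (h : G =ᶠ[𝓝 x] G') : curvature G x = curvature G' x := by
  have h' : christoffel G =ᶠ[𝓝 x] christoffel G' := by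
    filter_upwards [h.eventuallyEq_nhds] with y hy using christoffel_congr hy
  ext v w u
  simp only [curvature, christoffel_congr h, h'.fderiv_eq]

theorem ricci_congr (h : G =ᶠ[𝓝 x] G') : ricci G x = ricci G' x := by
  ext v w
  simp only [ricci_apply, curvature_congr h]

theorem einstein_congr [FiniteDimensional ℝ E] (h : G =ᶠ[𝓝 x] G') :
    einstein G x = einstein G' x := by
  ext v w
  simp only [einstein, scalar, ricci_congr h, h.eq_of_nhds]

/-- The derivative of `y ↦ f y v w` for a differentiable field `f` of bilinear maps. -/
theorem hasFDerivAt_apply_apply {V : Type*} [NormedAddCommGroup V] [NormedSpace ℝ V]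
    {f : E → E →L[ℝ] E →L[ℝ] V} (hf : DifferentiableAt ℝ f x) (v w : E) :
    HasFDerivAt (fun y => f y v w) (((fderiv ℝ f x).flip v).flip w) x := by
  convert (hf.hasFDerivAt.clm_apply (hasFDerivAt_const v x)).clm_apply (hasFDerivAt_const w x)
    using 1
  ext u; simp

theorem fderiv_apply_apply {V : Type*} [NormedAddCommGroup V] [NormedSpace ℝ V]
    {f : E → E →L[ℝ] E →L[ℝ] V} (hf : DifferentiableAt ℝ f x) (u v w : E) :
    fderiv ℝ f x u v w = fderiv ℝ (fun y => f y v w) x u := by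
  rw [(hasFDerivAt_apply_apply hf v w).fderiv]; rfl

namespace IsMetricAt

theorem congr (hG : IsMetricAt G x) (h : G =ᶠ[𝓝 x] G') : IsMetricAt G' x where
  contDiffAt := hG.contDiffAt.congr_of_eventuallyEq h.symm
  symm := by
    filter_upwards [h, hG.symm] with y hy hs v w
    rw [← hy, hs]
  isInvertible := h.eq_of_nhds ▸ hG.isInvertible

theorem symm_self (hG : IsMetricAt G x) (v w : E) : G x v w = G x w v :=
  hG.symm.self_of_nhds v w

theorem eventually [CompleteSpace E] (hG : IsMetricAt G x) : ∀ᶠ y in 𝓝 x, IsMetricAt G y := by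
  have hinv : ∀ᶠ y in 𝓝 x, (G y).IsInvertible := by
    obtain ⟨e, he⟩ := hG.isInvertible
    have := hG.contDiffAt.continuousAt.eventually
      (by rw [← he]; exact ContinuousLinearEquiv.nhds e)
    filter_upwards [this] with y hy
    obtain ⟨e', he'⟩ := hy
    exact ⟨e', he'⟩
  filter_upwards [hG.contDiffAt.eventually (by simp), hG.symm.eventually_nhds, hinv]
    with y h1 h2 h3 using ⟨h1, h2, h3⟩

theorem differentiableAt (hG : IsMetricAt G x) : DifferentiableAt ℝ G x :=
  hG.contDiffAt.differentiableAt (by simp)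

theorem fderiv_symm (hG : IsMetricAt G x) (u v w : E) :
    fderiv ℝ G x u v w = fderiv ℝ G x u w v := by
  have h3 : (fun y => G y v w) =ᶠ[𝓝 x] (fun y => G y w v) := by
    filter_upwards [hG.symm] with y hy using hy v w
  rw [fderiv_apply_apply hG.differentiableAt, fderiv_apply_apply hG.differentiableAt, h3.fderiv_eq]

theorem apply_christoffel (hG : IsMetricAt G x) (v w : E) :
    G x (christoffel G x v w) = christoffelFirst G x v w := by
  rw [christoffel_apply, hG.isInvertible.self_apply_inverse]

/-- Uniqueness in the defining property of the Levi-Civita connection. -/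
theorem christoffel_eq (hG : IsMetricAt G x) {v w a : E}
    (h : ∀ u, G x a u = christoffelFirst G x v w u) : christoffel G x v w = a := by
  apply hG.isInvertible.injective
  rw [hG.apply_christoffel]
  ext u
  exact (h u).symm

theorem christoffel_symm (hG : IsMetricAt G x) (v w : E) :
    christoffel G x v w = christoffel G x w v := by
  apply hG.christoffel_eq
  intro u
  rw [hG.apply_christoffel, christoffelFirst_apply, christoffelFirst_apply,
    hG.fderiv_symm u w v]
  ring

/-- Compatibility of the connection with the metric. -/
theorem fderiv_apply (hG : IsMetricAt G x) (u v w : E) :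
    fderiv ℝ G x u v w = G x (christoffel G x u v) w + G x v (christoffel G x u w) := by
  rw [hG.symm_self v, hG.apply_christoffel, hG.apply_christoffel, christoffelFirst_apply,
    christoffelFirst_apply, hG.fderiv_symm u w v, hG.fderiv_symm v u w]
  ring

theorem contDiffAt_fderiv (hG : IsMetricAt G x) : ContDiffAt ℝ 1 (fderiv ℝ G) x :=
  hG.contDiffAt.fderiv_right (by norm_num)

theorem contDiffAt_christoffelFirst (hG : IsMetricAt G x) :
    ContDiffAt ℝ 1 (christoffelFirst G) x := by
  have h := hG.contDiffAt_fderiv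
  have hf : ContDiffAt ℝ 1 (fun y => (fderiv ℝ G y).flip) x :=
    (ContinuousLinearMap.flipₗᵢ ℝ E E (E →L[ℝ] ℝ)).contDiff.contDiffAt.comp x h
  exact ((h.add hf).sub (contDiffAt_const.clm_comp hf)).const_smul (2⁻¹ : ℝ)

theorem contDiffAt_inverse [CompleteSpace E] (hG : IsMetricAt G x) :
    ContDiffAt ℝ 2 (fun y => (G y).inverse) x :=
  hG.isInvertible.contDiffAt_map_inverse.comp x hG.contDiffAt

theorem contDiffAt_christoffel [CompleteSpace E] (hG : IsMetricAt G x) :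
    ContDiffAt ℝ 1 (christoffel G) x := by
  have h := hG.contDiffAt_christoffelFirst
  have hi : ContDiffAt ℝ 1 (fun y => (G y).inverse) x := hG.contDiffAt_inverse.of_le (by norm_num)
  exact ((ContinuousLinearMap.compL ℝ E (E →L[ℝ] ℝ) E).contDiff.contDiffAt.comp x hi).clm_comp h

theorem differentiableAt_christoffel [CompleteSpace E] (hG : IsMetricAt G x) :
    DifferentiableAt ℝ (christoffel G) x :=
  hG.contDiffAt_christoffel.differentiableAt (by simp)

end IsMetricAt

namespace IsMetricAt

/-- The curvature endomorphisms are skew-adjoint. -/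
theorem apply_curvature_self [CompleteSpace E] (hG : IsMetricAt G x) (u v w : E) :
    G x (curvature G x v w u) w = 0 := by
  -- The first kind symbols `Γ(v, w, w)` are half the derivative of `G(w, w)` in the direction `v`.
  have key : ∀ u v : E, G x (fderiv ℝ (christoffel G) x u v w) w +
      G x (christoffel G x u (christoffel G x v w)) w =
      2⁻¹ * fderiv ℝ (fderiv ℝ G) x u v w w - G x (christoffel G x v w) (christoffel G x u w) := by
    intro u v
    have hd2 : DifferentiableAt ℝ (fderiv ℝ G) x := hG.contDiffAt_fderiv.differentiableAt (by simp)
    have h1 : HasFDerivAt (fun y => G y (christoffel G y v w) w) _ x :=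
      ((hG.differentiableAt.hasFDerivAt.clm_apply
        (hasFDerivAt_apply_apply hG.differentiableAt_christoffel v w)).clm_apply
          (hasFDerivAt_const w x))
    have h2 : (fun y => G y (christoffel G y v w) w) =ᶠ[𝓝 x]
        fun y => 2⁻¹ * fderiv ℝ G y v w w := by
      filter_upwards [hG.eventually] with y hy
      rw [hy.apply_christoffel, christoffelFirst_apply, hy.fderiv_symm w v w]
      ring
    have h3 : HasFDerivAt (fun y => 2⁻¹ * fderiv ℝ G y v w w) _ x :=
      (((hd2.hasFDerivAt.clm_apply (hasFDerivAt_const v x)).clm_apply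
        (hasFDerivAt_const w x)).clm_apply (hasFDerivAt_const w x)).const_mul 2⁻¹
    have h4 := DFunLike.congr_fun ((h3.congr_of_eventuallyEq h2).unique h1) u
    simp at h4
    rw [hG.fderiv_apply] at h4
    linarith
  have hs : IsSymmSndFDerivAt ℝ G x := hG.contDiffAt.isSymmSndFDerivAt (by simp)
  have e1 := key u v
  have e2 := key v u
  rw [hs.eq u v] at e1
  rw [hG.symm_self (christoffel G x v w)] at e1
  rw [curvature_apply]
  simp only [map_sub, map_add, sub_apply, add_apply]
  linarith

end IsMetricAt

end Christoffel

/-! ### Gradient and Hessian of a function -/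

section Hessian

/-- The gradient of the function `ρ`. -/
def grad (G : E → E →L[ℝ] E →L[ℝ] ℝ) (ρ : E → ℝ) (x : E) : E := (G x).inverse (fderiv ℝ ρ x)

/-- The Hessian `(v, w) ↦ ∂_v ∂_w ρ - ∂_{Γ(v, w)} ρ` of the function `ρ`. -/
def hess (G : E → E →L[ℝ] E →L[ℝ] ℝ) (ρ : E → ℝ) (x v w : E) : ℝ :=
  fderiv ℝ (fderiv ℝ ρ) x v w - fderiv ℝ ρ x (christoffel G x v w)

variable {G : E → E →L[ℝ] E →L[ℝ] ℝ} {ρ : E → ℝ} {x : E}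

theorem IsMetricAt.apply_grad (hG : IsMetricAt G x) (v : E) :
    G x (grad G ρ x) v = fderiv ℝ ρ x v := by
  rw [grad, hG.isInvertible.self_apply_inverse]

theorem IsMetricAt.hess_symm (hG : IsMetricAt G x) (hρ : ContDiffAt ℝ 2 ρ x) (v w : E) :
    hess G ρ x v w = hess G ρ x w v := by
  rw [hess, hess, hG.christoffel_symm v w, (hρ.isSymmSndFDerivAt (by simp)).eq v w]

theorem hess_congr {G' : E → E →L[ℝ] E →L[ℝ] ℝ} {ρ' : E → ℝ} (hG : G =ᶠ[𝓝 x] G')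
    (hρ : ρ =ᶠ[𝓝 x] ρ') : hess G ρ x = hess G' ρ' x := by
  ext v w
  rw [hess, hess, christoffel_congr hG, hρ.fderiv_eq, hρ.fderiv.fderiv_eq]

variable [CompleteSpace E]

theorem IsMetricAt.differentiableAt_grad (hG : IsMetricAt G x) (hρ : ContDiffAt ℝ 2 ρ x) :
    DifferentiableAt ℝ (grad G ρ) x :=
  (hG.contDiffAt_inverse.differentiableAt (by simp)).clm_apply
    ((hρ.fderiv_right (m := 1) (by norm_num)).differentiableAt (by simp))

/-- The Hessian is the covariant derivative of the gradient. -/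
theorem IsMetricAt.apply_covariantDeriv_grad (hG : IsMetricAt G x) (hρ : ContDiffAt ℝ 2 ρ x)
    (u w : E) :
    G x (fderiv ℝ (grad G ρ) x u + christoffel G x u (grad G ρ x)) w = hess G ρ x u w := by
  have h1 : HasFDerivAt (fun y => G y (grad G ρ y) w) _ x :=
    (hG.differentiableAt.hasFDerivAt.clm_apply
      (hG.differentiableAt_grad hρ).hasFDerivAt).clm_apply (hasFDerivAt_const w x)
  have h2 : (fun y => G y (grad G ρ y) w) =ᶠ[𝓝 x] fun y => fderiv ℝ ρ y w := by
    filter_upwards [hG.eventually] with y hy using hy.apply_grad w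
  have h3 : HasFDerivAt (fun y => fderiv ℝ ρ y w) _ x :=
    (((hρ.fderiv_right (m := 1) (by norm_num)).differentiableAt (by simp)).hasFDerivAt).clm_apply
      (hasFDerivAt_const w x)
  have h4 := DFunLike.congr_fun ((h3.congr_of_eventuallyEq h2).unique h1) u
  simp at h4
  rw [hG.fderiv_apply, hG.apply_grad] at h4
  simp only [map_add, add_apply]
  rw [hess]
  linarith

end Hessian

/-! ### Change of coordinates -/

section ChangeOfCoordinates

variable {E₁ : Type*} [NormedAddCommGroup E₁] [NormedSpace ℝ E₁]
  {G : E → E →L[ℝ] E →L[ℝ] ℝ} {ρ : E → ℝ} {τ : E₁ → E} {x : E₁}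

/-- The transformation law of the Christoffel symbols. -/
theorem IsMetricAt.fderiv_christoffel_pullback (hG : IsMetricAt G (τ x))
    (hτ : ContDiffAt ℝ 2 τ x)
    (hG' : IsMetricAt (fun y => pullbackForm (G (τ y)) (fderiv ℝ τ y)) x)
    (hsurj : Function.Surjective (fderiv ℝ τ x)) (v w : E₁) :
    fderiv ℝ τ x (christoffel (fun y => pullbackForm (G (τ y)) (fderiv ℝ τ y)) x v w) =
      fderiv ℝ (fderiv ℝ τ) x v w + christoffel G (τ x) (fderiv ℝ τ x v) (fderiv ℝ τ x w) := by
  set G' := fun y => pullbackForm (G (τ y)) (fderiv ℝ τ y) with hG'def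
  have hdτ : HasFDerivAt τ (fderiv ℝ τ x) x := (hτ.differentiableAt (by simp)).hasFDerivAt
  have hd2 : HasFDerivAt (fderiv ℝ τ) (fderiv ℝ (fderiv ℝ τ) x) x :=
    ((hτ.fderiv_right (m := 1) (by norm_num)).differentiableAt (by simp)).hasFDerivAt
  have hs : IsSymmSndFDerivAt ℝ τ x := hτ.isSymmSndFDerivAt (by simp)
  have hGτ : HasFDerivAt (fun y => G (τ y)) ((fderiv ℝ G (τ x)).comp (fderiv ℝ τ x)) x :=
    hG.differentiableAt.hasFDerivAt.comp x hdτ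
  have key : ∀ a b c : E₁, fderiv ℝ G' x a b c =
      fderiv ℝ G (τ x) (fderiv ℝ τ x a) (fderiv ℝ τ x b) (fderiv ℝ τ x c) +
      G (τ x) (fderiv ℝ (fderiv ℝ τ) x a b) (fderiv ℝ τ x c) +
      G (τ x) (fderiv ℝ τ x b) (fderiv ℝ (fderiv ℝ τ) x a c) := by
    intro a b c
    rw [fderiv_apply_apply hG'.differentiableAt]
    have h1 : HasFDerivAt (fun y => G' y b c) _ x :=
      (hGτ.clm_apply (hd2.clm_apply (hasFDerivAt_const b x))).clm_apply
        (hd2.clm_apply (hasFDerivAt_const c x))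
    rw [h1.fderiv]
    simp
    ring
  apply hG.isInvertible.injective
  ext z
  obtain ⟨u, rfl⟩ := hsurj z
  have h1 : G' x (christoffel G' x v w) u = christoffelFirst G' x v w u := by
    rw [hG'.apply_christoffel]
  rw [christoffelFirst_apply, key, key, key, hG'def, pullbackForm_apply] at h1
  rw [h1, map_add, hG.apply_christoffel, add_apply, christoffelFirst_apply,
    hs.eq w v, hs.eq u v, hs.eq u w, hG.symm_self (fderiv ℝ τ x w),
    hG.symm_self (fderiv ℝ τ x v)]
  ring

/-- The Hessian does not depend on the coordinates. -/
theorem IsMetricAt.hess_pullback (hG : IsMetricAt G (τ x)) (hρ : ContDiffAt ℝ 2 ρ (τ x))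
    (hτ : ContDiffAt ℝ 2 τ x)
    (hG' : IsMetricAt (fun y => pullbackForm (G (τ y)) (fderiv ℝ τ y)) x)
    (hsurj : Function.Surjective (fderiv ℝ τ x)) (v w : E₁) :
    hess (fun y => pullbackForm (G (τ y)) (fderiv ℝ τ y)) (ρ ∘ τ) x v w =
      hess G ρ (τ x) (fderiv ℝ τ x v) (fderiv ℝ τ x w) := by
  have hdτ : HasFDerivAt τ (fderiv ℝ τ x) x := (hτ.differentiableAt (by simp)).hasFDerivAt
  have hd2 : HasFDerivAt (fderiv ℝ τ) (fderiv ℝ (fderiv ℝ τ) x) x :=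
    ((hτ.fderiv_right (m := 1) (by norm_num)).differentiableAt (by simp)).hasFDerivAt
  have hdρ : HasFDerivAt (fderiv ℝ ρ) (fderiv ℝ (fderiv ℝ ρ) (τ x)) (τ x) :=
    ((hρ.fderiv_right (m := 1) (by norm_num)).differentiableAt (by simp)).hasFDerivAt
  have h1 : fderiv ℝ (ρ ∘ τ) =ᶠ[𝓝 x] fun y => (fderiv ℝ ρ (τ y)).comp (fderiv ℝ τ y) := by
    filter_upwards [hτ.eventually (by simp), hτ.continuousAt.eventually (hρ.eventually (by simp))]
      with y hy1 hy2
    exact fderiv_comp y (hy2.differentiableAt (by simp)) (hy1.differentiableAt (by simp))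
  have h2 : HasFDerivAt (fun y => (fderiv ℝ ρ (τ y)).comp (fderiv ℝ τ y)) _ x :=
    (hdρ.comp x hdτ).clm_comp hd2
  rw [hess, hess, h1.fderiv_eq, h2.fderiv, h1.eq_of_nhds, ContinuousLinearMap.comp_apply,
    hG.fderiv_christoffel_pullback hτ hG' hsurj]
  simp

end ChangeOfCoordinates

end ChartMetric

/-! ### Traces -/

section Trace

/-- The trace of an endomorphism of a product is the sum of the traces of its diagonal blocks. -/
theorem trace_eq_add_of_prod {V W : Type*} [AddCommGroup V] [Module ℝ V] [FiniteDimensional ℝ V]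
    [AddCommGroup W] [Module ℝ W] [FiniteDimensional ℝ W] (f : V × W →ₗ[ℝ] V × W) :
    LinearMap.trace ℝ (V × W) f =
      LinearMap.trace ℝ V (LinearMap.fst ℝ V W ∘ₗ f ∘ₗ LinearMap.inl ℝ V W) +
        LinearMap.trace ℝ W (LinearMap.snd ℝ V W ∘ₗ f ∘ₗ LinearMap.inr ℝ V W) := by
  have h : f = (f ∘ₗ LinearMap.inl ℝ V W) ∘ₗ LinearMap.fst ℝ V W +
      (f ∘ₗ LinearMap.inr ℝ V W) ∘ₗ LinearMap.snd ℝ V W := by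
    have h0 : ((0, 0) : V × W) = 0 := rfl
    ext <;> simp [h0]
  conv_lhs => rw [h]
  rw [map_add, LinearMap.trace_comp_comm', LinearMap.trace_comp_comm' _ (LinearMap.snd ℝ V W)]

variable {E : Type*} [NormedAddCommGroup E] [NormedSpace ℝ E]

/-- Expansion of a vector in the basis formed by two null vectors that are not orthogonal. -/
theorem eq_add_of_null (hE : Module.finrank ℝ E = 2) {B : E →L[ℝ] E →L[ℝ] ℝ}
    (hB : ∀ v w, B v w = B w v) {n l : E} (hn : B n n = 0) (hl : B l l = 0) (hnl : B n l ≠ 0)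
    (w : E) : w = (B w l / B n l) • n + (B w n / B n l) • l := by
  have hli : LinearIndependent ℝ ![n, l] := by
    rw [LinearIndependent.pair_iff]
    intro s t hst
    have h1 := congrArg (B n) hst
    have h2 := congrArg (B l) hst
    simp [hn, hl, hnl, hB l n] at h1 h2
    exact ⟨h2, h1⟩
  have hs : w ∈ Submodule.span ℝ (Set.range ![n, l]) := by
    rw [hli.span_eq_top_of_card_eq_finrank (by simp [hE])]
    trivial
  simp only [Matrix.range_cons, Matrix.range_empty, Set.union_empty, Set.singleton_union,
    Submodule.mem_span_pair] at hs
  obtain ⟨a, b, rfl⟩ := hs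
  simp only [map_add, map_smul, add_apply, smul_apply, hn, hl, hB l n, smul_eq_mul, mul_zero,
    zero_add, add_zero, mul_div_cancel_right₀ _ hnl]

theorem trace_eq_of_null (hE : Module.finrank ℝ E = 2) {B : E →L[ℝ] E →L[ℝ] ℝ}
    (hB : ∀ v w, B v w = B w v) {n l : E} (hn : B n n = 0) (hl : B l l = 0) (hnl : B n l ≠ 0)
    (A : E →ₗ[ℝ] E) : LinearMap.trace ℝ E A = (B (A n) l + B (A l) n) / B n l := by
  have : FiniteDimensional ℝ E := Module.finite_of_finrank_pos (by omega)
  have h : A = ((B n l)⁻¹ • (B.flip l).toLinearMap).smulRight (A n) +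
      ((B n l)⁻¹ • (B.flip n).toLinearMap).smulRight (A l) := by
    ext w
    conv_lhs => rw [eq_add_of_null hE hB hn hl hnl w]
    simp [div_eq_inv_mul]
  conv_lhs => rw [h]
  rw [map_add, LinearMap.trace_smulRight, LinearMap.trace_smulRight]
  simp
  ring

end Trace

namespace ChartMetric

variable {E : Type*} [NormedAddCommGroup E] [NormedSpace ℝ E]

/-- The Ricci tensor of a surface vanishes on null vectors: in the null basis `n, l`, the trace of
`u ↦ R(u, n) n` involves only `R(n, n) n = 0` and `G(R(l, n) n, n) = 0`. -/
theorem IsMetricAt.ricci_null [CompleteSpace E] (hE : Module.finrank ℝ E = 2)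
    {G : E → E →L[ℝ] E →L[ℝ] ℝ} {x : E} (hG : IsMetricAt G x) {n l : E} (hn : G x n n = 0)
    (hl : G x l l = 0) (hnl : G x n l ≠ 0) : ricci G x n n = 0 := by
  have h1 : curvature G x n n n = 0 := by rw [curvature_apply]; abel
  rw [ricci_apply, trace_eq_of_null hE hG.symm_self hn hl hnl]
  simp [h1, hG.apply_curvature_self]

/-- The Laplacian (d'Alembertian) of `ρ`, the divergence of its gradient. -/
def box (G : E → E →L[ℝ] E →L[ℝ] ℝ) (ρ : E → ℝ) (x : E) : ℝ :=
  LinearMap.trace ℝ E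
    (fderiv ℝ (grad G ρ) x + (christoffel G x).flip (grad G ρ x)).toLinearMap

/-- The Laplacian on a surface, in terms of two null vectors. -/
theorem IsMetricAt.box_eq [CompleteSpace E] (hE : Module.finrank ℝ E = 2)
    {G : E → E →L[ℝ] E →L[ℝ] ℝ} {x : E} (hG : IsMetricAt G x) {ρ : E → ℝ}
    (hρ : ContDiffAt ℝ 2 ρ x) {n l : E} (hn : G x n n = 0)
    (hl : G x l l = 0) (hnl : G x n l ≠ 0) : box G ρ x = 2 * hess G ρ x n l / G x n l := by
  have := hG.apply_covariantDeriv_grad hρ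
  rw [box, trace_eq_of_null hE hG.symm_self hn hl hnl]
  simp only [ContinuousLinearMap.coe_coe, add_apply, ContinuousLinearMap.flip_apply] at this ⊢
  rw [this, this, hG.hess_symm hρ l n]
  ring

/-! ### Curvature of a warped product -/

section Warped

variable {E' : Type*} [NormedAddCommGroup E'] [NormedSpace ℝ E']

/-- The warped product metric `g + ρ² h` on a product of two vector spaces. -/
def warped (g : E → E →L[ℝ] E →L[ℝ] ℝ) (h : E' → E' →L[ℝ] E' →L[ℝ] ℝ) (ρ : E → ℝ) (z : E × E') :
    E × E' →L[ℝ] E × E' →L[ℝ] ℝ :=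
  pullbackForm (g z.1) (ContinuousLinearMap.fst ℝ E E') +
    ρ z.1 ^ 2 • pullbackForm (h z.2) (ContinuousLinearMap.snd ℝ E E')

variable {g : E → E →L[ℝ] E →L[ℝ] ℝ} {h : E' → E' →L[ℝ] E' →L[ℝ] ℝ} {ρ : E → ℝ} {z : E × E'}

theorem warped_apply (v w : E × E') :
    warped g h ρ z v w = g z.1 v.1 w.1 + ρ z.1 ^ 2 * h z.2 v.2 w.2 := rfl

/-- The explicit two-sided inverse `α ↦ (g⁻¹ α₁, ρ⁻² h⁻¹ α₂)` of the warped product metric. -/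
theorem isInverse_warped (hg : IsMetricAt g z.1) (hh : IsMetricAt h z.2) (h0 : ρ z.1 ≠ 0) :
    let J : (E × E' →L[ℝ] ℝ) →L[ℝ] E × E' :=
      ((g z.1).inverse ∘L ContinuousLinearMap.precomp ℝ (ContinuousLinearMap.inl ℝ E E')).prod
        ((ρ z.1 ^ 2)⁻¹ • (h z.2).inverse ∘L
          ContinuousLinearMap.precomp ℝ (ContinuousLinearMap.inr ℝ E E'))
    warped g h ρ z ∘L J = .id ℝ _ ∧ J ∘L warped g h ρ z = .id ℝ _ := by
  have hg1 := hg.isInvertible.self_apply_inverse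
  have hh1 := hh.isInvertible.self_apply_inverse
  have hg2 := hg.isInvertible.inverse_apply_self
  have hh2 := hh.isInvertible.inverse_apply_self
  refine ⟨?_, ?_⟩
  · ext α v
    · simp [warped_apply, hg1]
    · simp [warped_apply, hh1, h0]
  · have e1 : ∀ v, warped g h ρ z v ∘L ContinuousLinearMap.inl ℝ E E' = g z.1 v.1 := by
      intro v; ext a; simp [warped_apply]
    have e2 : ∀ v, warped g h ρ z v ∘L ContinuousLinearMap.inr ℝ E E' = ρ z.1 ^ 2 • h z.2 v.2 := by
      intro v; ext a; simp [warped_apply]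
    refine ContinuousLinearMap.ext fun v => Prod.ext ?_ ?_
    · simp [e1, hg2]
    · simp [e2, hh2, h0]

theorem inverse_warped_apply (hg : IsMetricAt g z.1) (hh : IsMetricAt h z.2) (h0 : ρ z.1 ≠ 0)
    (α : E × E' →L[ℝ] ℝ) :
    (warped g h ρ z).inverse α = ((g z.1).inverse (α ∘L ContinuousLinearMap.inl ℝ E E'),
      (ρ z.1 ^ 2)⁻¹ • (h z.2).inverse (α ∘L ContinuousLinearMap.inr ℝ E E')) := by
  obtain ⟨h1, h2⟩ := isInverse_warped hg hh h0
  rw [ContinuousLinearMap.inverse_eq h1 h2]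
  rfl

theorem isMetricAt_warped (hg : IsMetricAt g z.1) (hh : IsMetricAt h z.2)
    (hρ : ContDiffAt ℝ 2 ρ z.1) (h0 : ρ z.1 ≠ 0) : IsMetricAt (warped g h ρ) z where
  contDiffAt := by
    have h1 : ContDiffAt ℝ 2 (fun y : E × E' => g y.1) z := hg.contDiffAt.comp z contDiffAt_fst
    have h2 : ContDiffAt ℝ 2 (fun y : E × E' => h y.2) z := hh.contDiffAt.comp z contDiffAt_snd
    have h3 : ContDiffAt ℝ 2 (fun y : E × E' => ρ y.1) z := hρ.comp z contDiffAt_fst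
    exact (contDiffAt_const.clm_comp (h1.clm_comp contDiffAt_const)).add
      ((h3.pow 2).smul (contDiffAt_const.clm_comp (h2.clm_comp contDiffAt_const)))
  symm := by
    filter_upwards [continuous_fst.continuousAt.eventually hg.symm,
      continuous_snd.continuousAt.eventually hh.symm] with y h1 h2 v w
    rw [warped_apply, warped_apply, h1, h2]
  isInvertible := by
    obtain ⟨h1, h2⟩ := isInverse_warped hg hh h0
    exact .of_inverse h1 h2

theorem fderiv_warped (hg : IsMetricAt g z.1) (hh : IsMetricAt h z.2)
    (hρ : ContDiffAt ℝ 2 ρ z.1) (h0 : ρ z.1 ≠ 0) (u v w : E × E') :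
    fderiv ℝ (warped g h ρ) z u v w = fderiv ℝ g z.1 u.1 v.1 w.1 +
      2 * ρ z.1 * fderiv ℝ ρ z.1 u.1 * h z.2 v.2 w.2 +
      ρ z.1 ^ 2 * fderiv ℝ h z.2 u.2 v.2 w.2 := by
  rw [fderiv_apply_apply (isMetricAt_warped hg hh hρ h0).differentiableAt]
  have h1 : HasFDerivAt (fun y : E × E' => g y.1 v.1 w.1) _ z :=
    (hasFDerivAt_apply_apply hg.differentiableAt v.1 w.1).comp z hasFDerivAt_fst
  have h2 : HasFDerivAt (fun y : E × E' => h y.2 v.2 w.2) _ z :=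
    (hasFDerivAt_apply_apply hh.differentiableAt v.2 w.2).comp z hasFDerivAt_snd
  have h3 : HasFDerivAt (fun y : E × E' => ρ y.1) _ z :=
    (hρ.differentiableAt (by simp)).hasFDerivAt.comp z hasFDerivAt_fst
  have h4 : HasFDerivAt (fun y : E × E' => g y.1 v.1 w.1 + ρ y.1 ^ 2 * h y.2 v.2 w.2) _ z :=
    h1.add ((h3.pow 2).mul h2)
  simp only [warped_apply]
  rw [h4.fderiv]
  simp
  ring

theorem christoffel_warped (hg : IsMetricAt g z.1) (hh : IsMetricAt h z.2)
    (hρ : ContDiffAt ℝ 2 ρ z.1) (h0 : ρ z.1 ≠ 0) (v w : E × E') :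
    christoffel (warped g h ρ) z v w =
      (christoffel g z.1 v.1 w.1 - (ρ z.1 * h z.2 v.2 w.2) • grad g ρ z.1,
        christoffel h z.2 v.2 w.2 +
          (ρ z.1)⁻¹ • (fderiv ℝ ρ z.1 v.1 • w.2 + fderiv ℝ ρ z.1 w.1 • v.2)) := by
  refine (isMetricAt_warped hg hh hρ h0).christoffel_eq fun u => ?_
  rw [christoffelFirst_apply, fderiv_warped hg hh hρ h0, fderiv_warped hg hh hρ h0,
    fderiv_warped hg hh hρ h0, warped_apply]
  simp only [map_sub, map_add, map_smul, add_apply, sub_apply, smul_apply, smul_eq_mul,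
    hg.apply_christoffel, hh.apply_christoffel, hg.apply_grad, christoffelFirst_apply]
  rw [hh.symm_self w.2 u.2]
  field_simp
  ring

variable [CompleteSpace E] [CompleteSpace E']

theorem fderiv_christoffel_warped (hg : IsMetricAt g z.1) (hh : IsMetricAt h z.2)
    (hρ : ContDiffAt ℝ 2 ρ z.1) (h0 : ρ z.1 ≠ 0) (u v w : E × E') :
    fderiv ℝ (christoffel (warped g h ρ)) z u v w =
      (fderiv ℝ (christoffel g) z.1 u.1 v.1 w.1 -
        ((fderiv ℝ ρ z.1 u.1 * h z.2 v.2 w.2 + ρ z.1 * fderiv ℝ h z.2 u.2 v.2 w.2) •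
          grad g ρ z.1 + (ρ z.1 * h z.2 v.2 w.2) • fderiv ℝ (grad g ρ) z.1 u.1),
        fderiv ℝ (christoffel h) z.2 u.2 v.2 w.2 +
          ((-fderiv ℝ ρ z.1 u.1 / ρ z.1 ^ 2) •
            (fderiv ℝ ρ z.1 v.1 • w.2 + fderiv ℝ ρ z.1 w.1 • v.2) +
          (ρ z.1)⁻¹ • (fderiv ℝ (fderiv ℝ ρ) z.1 u.1 v.1 • w.2 +
            fderiv ℝ (fderiv ℝ ρ) z.1 u.1 w.1 • v.2))) := by
  rw [fderiv_apply_apply (isMetricAt_warped hg hh hρ h0).differentiableAt_christoffel]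
  have hev : (fun y => christoffel (warped g h ρ) y v w) =ᶠ[𝓝 z] fun y =>
      (christoffel g y.1 v.1 w.1 - (ρ y.1 * h y.2 v.2 w.2) • grad g ρ y.1,
        christoffel h y.2 v.2 w.2 +
          (ρ y.1)⁻¹ • (fderiv ℝ ρ y.1 v.1 • w.2 + fderiv ℝ ρ y.1 w.1 • v.2)) := by
    filter_upwards [continuous_fst.continuousAt.eventually hg.eventually,
      continuous_snd.continuousAt.eventually hh.eventually,
      continuous_fst.continuousAt.eventually (hρ.eventually (by simp)),
      continuous_fst.continuousAt.eventually (hρ.continuousAt.eventually_ne h0)]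
      with y h1 h2 h3 h4 using christoffel_warped h1 h2 h3 h4 v w
  have hd1 : HasFDerivAt (fun y : E × E' => christoffel g y.1 v.1 w.1) _ z :=
    (hasFDerivAt_apply_apply hg.differentiableAt_christoffel v.1 w.1).comp z hasFDerivAt_fst
  have hd2 : HasFDerivAt (fun y : E × E' => christoffel h y.2 v.2 w.2) _ z :=
    (hasFDerivAt_apply_apply hh.differentiableAt_christoffel v.2 w.2).comp z hasFDerivAt_snd
  have hd3 : HasFDerivAt (fun y : E × E' => h y.2 v.2 w.2) _ z :=
    (hasFDerivAt_apply_apply hh.differentiableAt v.2 w.2).comp z hasFDerivAt_snd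
  have hd4 : HasFDerivAt (fun y : E × E' => ρ y.1) _ z :=
    (hρ.differentiableAt (by simp)).hasFDerivAt.comp z hasFDerivAt_fst
  have hd5 : HasFDerivAt (fun y : E × E' => grad g ρ y.1) _ z :=
    (hg.differentiableAt_grad hρ).hasFDerivAt.comp z hasFDerivAt_fst
  have hd6 : HasFDerivAt (fun y : E × E' => fderiv ℝ ρ y.1) _ z :=
    ((hρ.fderiv_right (m := 1) (by norm_num)).differentiableAt
      (by simp)).hasFDerivAt.comp z hasFDerivAt_fst
  have hd7 : HasFDerivAt (fun y : E × E' => (ρ y.1)⁻¹) _ z :=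
    (hasDerivAt_inv h0).comp_hasFDerivAt z hd4
  have hd8 := hd6.clm_apply (hasFDerivAt_const v.1 z)
  have hd9 := hd6.clm_apply (hasFDerivAt_const w.1 z)
  have hd : HasFDerivAt (fun y : E × E' =>
      (christoffel g y.1 v.1 w.1 - (ρ y.1 * h y.2 v.2 w.2) • grad g ρ y.1,
        christoffel h y.2 v.2 w.2 +
          (ρ y.1)⁻¹ • (fderiv ℝ ρ y.1 v.1 • w.2 + fderiv ℝ ρ y.1 w.1 • v.2))) _ z :=
    (hd1.sub ((hd4.mul hd3).smul hd5)).prodMk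
      (hd2.add (hd7.smul ((hd8.smul_const w.2).add (hd9.smul_const v.2))))
  rw [hev.fderiv_eq, hd.fderiv]
  refine Prod.ext ?_ ?_
  · simp
    module
  · simp
    module

theorem curvature_warped_base_base (hg : IsMetricAt g z.1) (hh : IsMetricAt h z.2)
    (hρ : ContDiffAt ℝ 2 ρ z.1) (h0 : ρ z.1 ≠ 0) (u v w : E) :
    (curvature (warped g h ρ) z (v, 0) (w, 0) (u, 0)).1 = curvature g z.1 v w u := by
  simp [curvature_apply, fderiv_christoffel_warped hg hh hρ h0, christoffel_warped hg hh hρ h0]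

theorem curvature_warped_base_fiber (hg : IsMetricAt g z.1) (hh : IsMetricAt h z.2)
    (hρ : ContDiffAt ℝ 2 ρ z.1) (h0 : ρ z.1 ≠ 0) (u : E') (v w : E) :
    (curvature (warped g h ρ) z (v, 0) (w, 0) (0, u)).2 = -(hess g ρ z.1 v w / ρ z.1) • u := by
  simp [curvature_apply, fderiv_christoffel_warped hg hh hρ h0, christoffel_warped hg hh hρ h0,
    hess, smul_smul, ← add_smul, ← sub_smul, ← neg_smul]
  congr 1
  field_simp
  ring

theorem curvature_warped_fiber_base (hg : IsMetricAt g z.1) (hh : IsMetricAt h z.2)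
    (hρ : ContDiffAt ℝ 2 ρ z.1) (h0 : ρ z.1 ≠ 0) (u : E) (v w : E') :
    (curvature (warped g h ρ) z (0, v) (0, w) (u, 0)).1 = -(ρ z.1 * h z.2 v w) •
      (fderiv ℝ (grad g ρ) z.1 u + christoffel g z.1 u (grad g ρ z.1)) := by
  simp [curvature_apply, fderiv_christoffel_warped hg hh hρ h0, christoffel_warped hg hh hρ h0]
  match_scalars <;> field_simp
  ring

theorem curvature_warped_fiber_fiber (hg : IsMetricAt g z.1) (hh : IsMetricAt h z.2)
    (hρ : ContDiffAt ℝ 2 ρ z.1) (h0 : ρ z.1 ≠ 0) (u v w : E') :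
    (curvature (warped g h ρ) z (0, v) (0, w) (0, u)).2 = curvature h z.2 v w u -
      fderiv ℝ ρ z.1 (grad g ρ z.1) • (h z.2 v w • u - h z.2 u w • v) := by
  simp [curvature_apply, fderiv_christoffel_warped hg hh hρ h0, christoffel_warped hg hh hρ h0]
  match_scalars <;> field_simp

variable [FiniteDimensional ℝ E] [FiniteDimensional ℝ E']

theorem ricci_warped_base (hg : IsMetricAt g z.1) (hh : IsMetricAt h z.2)
    (hρ : ContDiffAt ℝ 2 ρ z.1) (h0 : ρ z.1 ≠ 0) (v w : E) :
    ricci (warped g h ρ) z (v, 0) (w, 0) =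
      ricci g z.1 v w - Module.finrank ℝ E' * hess g ρ z.1 v w / ρ z.1 := by
  rw [ricci_apply, trace_eq_add_of_prod]
  have h1 : LinearMap.fst ℝ E E' ∘ₗ (curvature (warped g h ρ) z (v, 0) (w, 0)).toLinearMap ∘ₗ
      LinearMap.inl ℝ E E' = (curvature g z.1 v w).toLinearMap := by
    ext u; simp [curvature_warped_base_base hg hh hρ h0]
  have h2 : LinearMap.snd ℝ E E' ∘ₗ (curvature (warped g h ρ) z (v, 0) (w, 0)).toLinearMap ∘ₗ
      LinearMap.inr ℝ E E' = -(hess g ρ z.1 v w / ρ z.1) • LinearMap.id := by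
    ext u; simp [curvature_warped_base_fiber hg hh hρ h0]
  rw [h1, h2, map_smul, LinearMap.trace_id, ricci_apply, smul_eq_mul]
  ring

theorem ricci_warped_fiber (hg : IsMetricAt g z.1) (hh : IsMetricAt h z.2)
    (hρ : ContDiffAt ℝ 2 ρ z.1) (h0 : ρ z.1 ≠ 0) (v w : E') :
    ricci (warped g h ρ) z (0, v) (0, w) =
      ricci h z.2 v w - (ρ z.1 * box g ρ z.1 +
        (Module.finrank ℝ E' - 1) * fderiv ℝ ρ z.1 (grad g ρ z.1)) * h z.2 v w := by
  rw [ricci_apply, trace_eq_add_of_prod]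
  have h1 : LinearMap.fst ℝ E E' ∘ₗ (curvature (warped g h ρ) z (0, v) (0, w)).toLinearMap ∘ₗ
      LinearMap.inl ℝ E E' = -(ρ z.1 * h z.2 v w) •
        (fderiv ℝ (grad g ρ) z.1 + (christoffel g z.1).flip (grad g ρ z.1)).toLinearMap := by
    ext u
    simpa using curvature_warped_fiber_base hg hh hρ h0 u v w
  have h2 : LinearMap.snd ℝ E E' ∘ₗ (curvature (warped g h ρ) z (0, v) (0, w)).toLinearMap ∘ₗ
      LinearMap.inr ℝ E E' = (curvature h z.2 v w).toLinearMap -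
        fderiv ℝ ρ z.1 (grad g ρ z.1) • (h z.2 v w • LinearMap.id -
          ((h z.2).flip w).toLinearMap.smulRight v) := by
    ext u; simp [curvature_warped_fiber_fiber hg hh hρ h0]
  rw [h1, h2, map_smul, map_sub, map_smul, map_sub, map_smul, LinearMap.trace_id,
    LinearMap.trace_smulRight, ricci_apply, ← box, smul_eq_mul, smul_eq_mul, smul_eq_mul]
  simp
  ring

/-- The scalar curvature of a warped product over a surface, in terms of its Ricci tensor along the
base. -/
theorem scalar_warped (hE : Module.finrank ℝ E = 2) (hg : IsMetricAt g z.1)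
    (hh : IsMetricAt h z.2) (hρ : ContDiffAt ℝ 2 ρ z.1) (h0 : ρ z.1 ≠ 0) {n l : E}
    (hn : g z.1 n n = 0) (hl : g z.1 l l = 0) (hnl : g z.1 n l ≠ 0) :
    scalar (warped g h ρ) z =
      (ricci (warped g h ρ) z (n, 0) (l, 0) + ricci (warped g h ρ) z (l, 0) (n, 0)) / g z.1 n l +
      (scalar h z.2 - Module.finrank ℝ E' * (ρ z.1 * box g ρ z.1 +
        (Module.finrank ℝ E' - 1) * fderiv ℝ ρ z.1 (grad g ρ z.1))) / ρ z.1 ^ 2 := by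
  rw [scalar, trace_eq_add_of_prod]
  congr 1
  · rw [trace_eq_of_null hE hg.symm_self hn hl hnl]
    simp [inverse_warped_apply hg hh h0, hg.isInvertible.self_apply_inverse]
  · set κ := ρ z.1 * box g ρ z.1 +
        (Module.finrank ℝ E' - 1) * fderiv ℝ ρ z.1 (grad g ρ z.1) with hκ
    have key : LinearMap.snd ℝ E E' ∘ₗ ((warped g h ρ z).inverse.toLinearMap ∘ₗ
        (LinearMap.toContinuousLinearMap : (E × E' →ₗ[ℝ] ℝ) ≃ₗ[ℝ] (E × E' →L[ℝ] ℝ)).toLinearMap ∘ₗ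
          ricci (warped g h ρ) z) ∘ₗ LinearMap.inr ℝ E E' =
        (ρ z.1 ^ 2)⁻¹ • (((h z.2).inverse.toLinearMap ∘ₗ
          (LinearMap.toContinuousLinearMap : (E' →ₗ[ℝ] ℝ) ≃ₗ[ℝ] (E' →L[ℝ] ℝ)).toLinearMap ∘ₗ
            ricci h z.2) - κ • LinearMap.id) := by
      refine LinearMap.ext fun u => ?_
      have e : (LinearMap.toContinuousLinearMap (ricci (warped g h ρ) z (0, u)) ∘L
          ContinuousLinearMap.inr ℝ E E' : E' →L[ℝ] ℝ) =
          LinearMap.toContinuousLinearMap (ricci h z.2 u) - κ • h z.2 u := by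
        ext w
        simp [ricci_warped_fiber hg hh hρ h0, hκ]
      simp [inverse_warped_apply hg hh h0, e, hh.isInvertible.inverse_apply_self]
    rw [key, map_smul, map_sub, map_smul, LinearMap.trace_id, ← scalar, smul_eq_mul, smul_eq_mul]
    field_simp

/-- On two null vectors of the base, the Einstein tensor reduces, up to a factor, to the trace of
the Ricci tensor over the fiber; the curvature of the base drops out. -/
theorem einstein_warped_add (hE : Module.finrank ℝ E = 2) (hg : IsMetricAt g z.1)
    (hh : IsMetricAt h z.2) (hρ : ContDiffAt ℝ 2 ρ z.1) (h0 : ρ z.1 ≠ 0) {n l : E}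
    (hn : g z.1 n n = 0) (hl : g z.1 l l = 0) (hnl : g z.1 n l ≠ 0) :
    einstein (warped g h ρ) z (n, 0) (l, 0) + einstein (warped g h ρ) z (l, 0) (n, 0) =
      -(g z.1 n l * scalar h z.2 - 2 * Module.finrank ℝ E' * (ρ z.1 * hess g ρ z.1 n l +
        (Module.finrank ℝ E' - 1) * fderiv ℝ ρ z.1 n * fderiv ℝ ρ z.1 l)) / ρ z.1 ^ 2 := by
  have hgr : fderiv ℝ ρ z.1 (grad g ρ z.1) * g z.1 n l =
      2 * fderiv ℝ ρ z.1 n * fderiv ℝ ρ z.1 l := by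
    have e := congrArg (fderiv ℝ ρ z.1) (eq_add_of_null hE hg.symm_self hn hl hnl (grad g ρ z.1))
    rw [map_add, map_smul, map_smul, hg.apply_grad, hg.apply_grad, smul_eq_mul, smul_eq_mul] at e
    rw [e]
    field_simp
    ring
  rw [einstein, einstein, scalar_warped hE hg hh hρ h0 hn hl hnl, hg.box_eq hE hρ hn hl hnl,
    warped_apply, warped_apply]
  simp only [map_zero, mul_zero, add_zero]
  rw [hg.symm_self l n]
  field_simp
  linear_combination 2 * (Module.finrank ℝ E' * (Module.finrank ℝ E' - 1) : ℝ) * hgr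

theorem einstein_warped_null (hE : Module.finrank ℝ E = 2) (hg : IsMetricAt g z.1)
    (hh : IsMetricAt h z.2) (hρ : ContDiffAt ℝ 2 ρ z.1) (h0 : ρ z.1 ≠ 0) {n l : E}
    (hn : g z.1 n n = 0) (hl : g z.1 l l = 0) (hnl : g z.1 n l ≠ 0) :
    einstein (warped g h ρ) z (n, 0) (n, 0) =
      -(Module.finrank ℝ E' * hess g ρ z.1 n n / ρ z.1) := by
  rw [einstein, ricci_warped_base hg hh hρ h0, hg.ricci_null hE hn hl hnl, warped_apply]
  simp [hn]

end Warped

end ChartMetric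

/-! ### From manifolds to charts -/

section ManifoldCharts

variable {E : Type*} [NormedAddCommGroup E] [NormedSpace ℝ E]
  {H : Type*} [TopologicalSpace H] {I : ModelWithCorners ℝ E H}
  {M : Type*} [TopologicalSpace M] [ChartedSpace H M]
  {g : ∀ x : M, TangentSpace I x →L[ℝ] TangentSpace I x →L[ℝ] ℝ}

/-- A field of bilinear forms takes the same value at equal points, the tangent spaces all being
identified with the model space. -/
theorem form_congr_base {x y : M} (hxy : x = y) (v w : E) :
    (g x : E →L[ℝ] E →L[ℝ] ℝ) v w = (g y : E →L[ℝ] E →L[ℝ] ℝ) v w := by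
  subst hxy; rfl

theorem comp_extChartAt_symm_eventuallyEq (r : M → ℝ) {x₀ x : M}
    (hx : x ∈ (extChartAt I x₀).source) :
    r ∘ (extChartAt I x).symm =ᶠ[𝓝 (extChartAt I x x)]
      (r ∘ (extChartAt I x₀).symm) ∘ (extChartAt I x₀ ∘ (extChartAt I x).symm) := by
  have hcont : ContinuousAt (extChartAt I x).symm (extChartAt I x x) :=
    continuousAt_extChartAt_symm x
  have hsrc : ∀ᶠ y in 𝓝 (extChartAt I x x), (extChartAt I x).symm y ∈ (extChartAt I x₀).source := by
    apply hcont.eventually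
    rw [extChartAt_to_inv]
    exact (isOpen_extChartAt_source x₀).mem_nhds hx
  filter_upwards [hsrc] with y hy
  simp only [Function.comp, (extChartAt I x₀).left_inv hy]

variable [I.Boundaryless] [IsManifold I ∞ M]

theorem mdifferentiableAt_extChartAt_symm {x : M} {y : E} (hy : y ∈ (extChartAt I x).target) :
    MDifferentiableAt 𝓘(ℝ, E) I (extChartAt I x).symm y := by
  have : IsManifold I 1 M := .of_le (n := ∞) (by simp)
  have h := mdifferentiableWithinAt_extChartAt_symm hy
  rwa [I.range_eq_univ, mdifferentiableWithinAt_univ] at h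

theorem isInvertible_mfderiv_extChartAt_symm {x : M} {y : E} (hy : y ∈ (extChartAt I x).target) :
    (mfderiv 𝓘(ℝ, E) I (extChartAt I x).symm y).IsInvertible := by
  have : IsManifold I 1 M := .of_le (n := ∞) (by simp)
  have h := isInvertible_mfderivWithin_extChartAt_symm hy
  rwa [I.range_eq_univ, mfderivWithin_univ] at h

theorem mfderiv_extChartAt_symm_apply {x y : M} (hy : y ∈ (extChartAt I x).source)
    (v : TangentSpace I y) :
    mfderiv 𝓘(ℝ, E) I (extChartAt I x).symm (extChartAt I x y)
      (mfderiv I 𝓘(ℝ, E) (extChartAt I x) y v) = v := by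
  have : IsManifold I 1 M := .of_le (n := ∞) (by simp)
  have h := mfderivWithin_extChartAt_symm_comp_mfderiv_extChartAt' hy
  rw [I.range_eq_univ, mfderivWithin_univ] at h
  exact DFunLike.congr_fun h v

theorem contDiffAt_extChartAt_comp_symm {x₀ x : M} (hx : x ∈ (extChartAt I x₀).source) :
    ContDiffAt ℝ 2 (extChartAt I x₀ ∘ (extChartAt I x).symm) (extChartAt I x x) := by
  rw [← contMDiffAt_iff_contDiffAt]
  have h1 : ContMDiffAt I 𝓘(ℝ, E) ∞ (extChartAt I x₀)
      ((extChartAt I x).symm (extChartAt I x x)) := by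
    rw [extChartAt_to_inv]
    exact contMDiffAt_extChartAt' (by rwa [← extChartAt_source (I := I)])
  have h2 : ContMDiffAt 𝓘(ℝ, E) I ∞ (extChartAt I x).symm (extChartAt I x x) :=
    (contMDiffOn_extChartAt_symm (I := I) (n := ∞) x).contMDiffAt (extChartAt_target_mem_nhds x)
  exact (h1.comp _ h2).of_le (by norm_cast)

theorem contDiffAt_comp_extChartAt_symm {r : M → ℝ} (hr : ContMDiff I 𝓘(ℝ, ℝ) ∞ r) (x : M) {y : E}
    (hy : y ∈ (extChartAt I x).target) : ContDiffAt ℝ 2 (r ∘ (extChartAt I x).symm) y := by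
  rw [← contMDiffAt_iff_contDiffAt]
  exact (hr.contMDiffAt.comp y ((contMDiffOn_extChartAt_symm (I := I) (n := ∞) x).contMDiffAt
    (extChartAt_target_mem_nhds' hy))).of_le (by norm_cast)

theorem metricInChart_mfderiv {x y : M} (hy : y ∈ (extChartAt I x).source)
    (v w : TangentSpace I y) :
    metricInChart I g x (extChartAt I x y) (mfderiv I 𝓘(ℝ, E) (extChartAt I x) y v)
      (mfderiv I 𝓘(ℝ, E) (extChartAt I x) y w) = g y v w := by
  refine Eq.trans ?_ (form_congr_base (E := E) (I := I) ((extChartAt I x).left_inv hy) v w)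
  exact congrArg₂
    (fun a b : E => (g ((extChartAt I x).symm (extChartAt I x y)) : E →L[ℝ] E →L[ℝ] ℝ) a b)
    (mfderiv_extChartAt_symm_apply hy v) (mfderiv_extChartAt_symm_apply hy w)

/-- The coordinate vector fields are smooth. -/
theorem contMDiffOn_mfderiv_extChartAt_symm (x : M) (v : E) :
    ContMDiffOn 𝓘(ℝ, E) I.tangent 2 (fun y => (⟨(extChartAt I x).symm y,
      mfderiv 𝓘(ℝ, E) I (extChartAt I x).symm y v⟩ : TangentBundle I M))
      (extChartAt I x).target := by
  have hM : IsManifold I 1 M := .of_le (n := ∞) (by simp)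
  have hopen := isOpen_extChartAt_target (I := I) x
  have h1 := ContMDiffOn.contMDiffOn_tangentMapWithin (m := 2)
    (contMDiffOn_extChartAt_symm (I := I) (n := ∞) x) (by norm_cast) hopen.uniqueMDiffOn
  have h2 : ContMDiff 𝓘(ℝ, E) 𝓘(ℝ, E).tangent 2
      (fun y : E => (⟨y, v⟩ : TangentBundle 𝓘(ℝ, E) E)) :=
    (contMDiff_vectorSpace_iff_contDiff (V := fun _ => v)).2 contDiff_const
  refine (h1.comp h2.contMDiffOn (fun y hy => hy)).congr fun y hy => ?_
  simp only [Function.comp, tangentMapWithin, mfderivWithin_of_isOpen hopen hy]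

/-- The expressions of a metric in two charts are related by the change of coordinates. -/
theorem metricInChart_eventuallyEq_pullbackForm {x₀ x : M}
    (hx : x ∈ (extChartAt I x₀).source) :
    metricInChart I g x =ᶠ[𝓝 (extChartAt I x x)] fun y =>
      pullbackForm (metricInChart I g x₀ ((extChartAt I x₀ ∘ (extChartAt I x).symm) y))
        (fderiv ℝ (extChartAt I x₀ ∘ (extChartAt I x).symm) y) := by
  have hM : IsManifold I 1 M := .of_le (n := ∞) (by simp)
  have hcont : ContinuousAt (extChartAt I x).symm (extChartAt I x x) :=
    continuousAt_extChartAt_symm x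
  have hsrc : ∀ᶠ y in 𝓝 (extChartAt I x x), (extChartAt I x).symm y ∈ (extChartAt I x₀).source := by
    apply hcont.eventually
    rw [extChartAt_to_inv]
    exact (isOpen_extChartAt_source x₀).mem_nhds hx
  filter_upwards [hsrc.eventually_nhds, extChartAt_target_mem_nhds (I := I) x] with y hy hyt
  have hy' := hy.self_of_nhds
  have hd1 : MDifferentiableAt 𝓘(ℝ, E) I (extChartAt I x).symm y :=
    mdifferentiableAt_extChartAt_symm hyt
  have hd2 : MDifferentiableAt I 𝓘(ℝ, E) (extChartAt I x₀) ((extChartAt I x).symm y) :=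
    mdifferentiableAt_extChartAt (by rwa [← extChartAt_source (I := I)])
  have hfd : ∀ v : E, mfderiv 𝓘(ℝ, E) I (extChartAt I x₀).symm
      (extChartAt I x₀ ((extChartAt I x).symm y))
      (fderiv ℝ (extChartAt I x₀ ∘ (extChartAt I x).symm) y v) =
      mfderiv 𝓘(ℝ, E) I (extChartAt I x).symm y v := by
    intro v
    rw [← mfderiv_eq_fderiv, mfderiv_comp y hd2 hd1]
    exact mfderiv_extChartAt_symm_apply hy' _
  ext v w
  refine (form_congr_base ((extChartAt I x₀).left_inv hy').symm _ _).trans ?_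
  exact (congrArg₂ (fun a b : E => (g ((extChartAt I x₀).symm
    (extChartAt I x₀ ((extChartAt I x).symm y))) : E →L[ℝ] E →L[ℝ] ℝ) a b) (hfd v) (hfd w)).symm

variable [FiniteDimensional ℝ E]

theorem contDiffOn_metricInChart
    (hg : ContMDiff I (I.prod 𝓘(ℝ, E →L[ℝ] E →L[ℝ] ℝ)) ∞
      (fun x ↦ TotalSpace.mk' (E →L[ℝ] E →L[ℝ] ℝ) x (g x))) (x : M) :
    ContDiffOn ℝ 2 (metricInChart I g x) (extChartAt I x).target := by
  have hM : IsManifold I 1 M := .of_le (n := ∞) (by simp)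
  rw [contDiffOn_clm_apply]
  intro v
  rw [contDiffOn_clm_apply]
  intro w
  rw [← contMDiffOn_iff_contDiffOn]
  intro y hy
  have hb : ContMDiffWithinAt 𝓘(ℝ, E) I 2 (extChartAt I x).symm (extChartAt I x).target y :=
    (contMDiffOn_extChartAt_symm (I := I) (n := ∞) x y hy).of_le (by norm_cast)
  have key : ContMDiffWithinAt 𝓘(ℝ, E) (I.prod 𝓘(ℝ)) 2
      (fun m ↦ TotalSpace.mk' ℝ (E := Bundle.Trivial M ℝ) ((extChartAt I x).symm m)
        (g ((extChartAt I x).symm m) (mfderiv 𝓘(ℝ, E) I (extChartAt I x).symm m v)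
          (mfderiv 𝓘(ℝ, E) I (extChartAt I x).symm m w))) (extChartAt I x).target y := by
    apply ContMDiffWithinAt.clm_bundle_apply₂ (F₁ := E) (F₂ := E)
    · exact ContMDiffAt.comp_contMDiffWithinAt y (hg.contMDiffAt.of_le (by norm_cast)) hb
    · exact contMDiffOn_mfderiv_extChartAt_symm x v y hy
    · exact contMDiffOn_mfderiv_extChartAt_symm x w y hy
  simp only [contMDiffWithinAt_totalSpace] at key
  exact key.2

/-- The chart expression of a smooth, symmetric and nondegenerate field of forms is a
pseudo-Riemannian metric. -/
theorem isMetricAt_metricInChart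
    (hg : ContMDiff I (I.prod 𝓘(ℝ, E →L[ℝ] E →L[ℝ] ℝ)) ∞
      (fun x ↦ TotalSpace.mk' (E →L[ℝ] E →L[ℝ] ℝ) x (g x)))
    (hsymm : ∀ x v w, g x v w = g x w v) (hnd : ∀ x v, (∀ w, g x v w = 0) → v = 0)
    (x : M) {y : E} (hy : y ∈ (extChartAt I x).target) :
    ChartMetric.IsMetricAt (metricInChart I g x) y where
  contDiffAt := (contDiffOn_metricInChart hg x).contDiffAt (extChartAt_target_mem_nhds' hy)
  symm := .of_forall fun y v w => hsymm _ _ _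
  isInvertible := by
    have hA := isInvertible_mfderiv_extChartAt_symm hy
    have hinj : Function.Injective (metricInChart I g x y).toLinearMap := by
      rw [← LinearMap.ker_eq_bot, LinearMap.ker_eq_bot']
      intro v hv
      refine hA.injective ((hnd _ _ fun w => ?_).trans (map_zero _).symm)
      obtain ⟨w, rfl⟩ := hA.surjective w
      exact DFunLike.congr_fun hv w
    have hdim : Module.finrank ℝ E = Module.finrank ℝ (E →L[ℝ] ℝ) := by
      rw [← (LinearMap.toContinuousLinearMap : (E →ₗ[ℝ] ℝ) ≃ₗ[ℝ] (E →L[ℝ] ℝ)).finrank_eq]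
      exact (Subspace.dual_finrank_eq (K := ℝ) (V := E)).symm
    refine ⟨((metricInChart I g x y).toLinearMap.linearEquivOfInjective
      hinj hdim).toContinuousLinearEquiv, ?_⟩
    ext v w
    rfl

/-- The dominant energy condition, read in the preferred chart at `x`. -/
theorem DominantEnergyCondition.einstein_nonneg (hdec : DominantEnergyCondition I g) (x : M)
    {v w : E} (hv0 : v ≠ 0) (hw0 : w ≠ 0)
    (hv : metricInChart I g x (extChartAt I x x) v v ≤ 0)
    (hw : metricInChart I g x (extChartAt I x x) w w ≤ 0)
    (hvw : metricInChart I g x (extChartAt I x x) v w < 0) :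
    0 ≤ ChartMetric.einstein (metricInChart I g x) (extChartAt I x x) v w := by
  have hM : IsManifold I 1 M := .of_le (n := ∞) (by simp)
  have hs := mem_extChartAt_source (I := I) x
  obtain ⟨v, rfl⟩ := (isInvertible_mfderiv_extChartAt hs).surjective v
  obtain ⟨w, rfl⟩ := (isInvertible_mfderiv_extChartAt hs).surjective w
  rw [metricInChart_mfderiv hs] at hv hw hvw
  exact hdec x v w (fun h => hv0 (by rw [h]; exact map_zero _))
    (fun h => hw0 (by rw [h]; exact map_zero _))
    hv hw hvw

end ManifoldCharts

section WarpedCharts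

variable {E : Type*} [NormedAddCommGroup E] [NormedSpace ℝ E]
  {H : Type*} [TopologicalSpace H] {I : ModelWithCorners ℝ E H}
  {Q : Type*} [TopologicalSpace Q] [ChartedSpace H Q]
  {E' : Type*} [NormedAddCommGroup E'] [NormedSpace ℝ E']
  {H' : Type*} [TopologicalSpace H'] {J : ModelWithCorners ℝ E' H'}
  {F : Type*} [TopologicalSpace F] [ChartedSpace H' F]
  (g : ∀ q : Q, TangentSpace I q →L[ℝ] TangentSpace I q →L[ℝ] ℝ)
  (h : ∀ f : F, TangentSpace J f →L[ℝ] TangentSpace J f →L[ℝ] ℝ) (r : Q → ℝ)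

theorem warpedMetric_apply (x : Q × F) (v w : E × E') :
    (warpedMetric I J g h r x : E × E' →L[ℝ] E × E' →L[ℝ] ℝ) v w =
      (g x.1 : E →L[ℝ] E →L[ℝ] ℝ) v.1 w.1 + r x.1 ^ 2 * (h x.2 : E' →L[ℝ] E' →L[ℝ] ℝ) v.2 w.2 := by
  unfold warpedMetric
  rw [mfderiv_fst, mfderiv_snd]
  rfl

variable [I.Boundaryless] [IsManifold I ∞ Q] [J.Boundaryless] [IsManifold J ∞ F]

/-- In a product chart, the warped product metric is the warped product of the expressions of the
two metrics. -/
theorem metricInChart_warpedMetric (x : Q × F) :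
    metricInChart (I.prod J) (warpedMetric I J g h r) x =ᶠ[𝓝 (extChartAt (I.prod J) x x)]
      ChartMetric.warped (metricInChart I g x.1) (metricInChart J h x.2)
        (r ∘ (extChartAt I x.1).symm) := by
  filter_upwards [extChartAt_target_mem_nhds (I := I.prod J) x] with z hz
  rw [extChartAt_prod, PartialEquiv.prod_target] at hz
  have hm : mfderiv 𝓘(ℝ, E × E') (I.prod J) (extChartAt (I.prod J) x).symm z =
      (mfderiv 𝓘(ℝ, E) I (extChartAt I x.1).symm z.1).prodMap
        (mfderiv 𝓘(ℝ, E') J (extChartAt J x.2).symm z.2) := by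
    rw [extChartAt_prod, PartialEquiv.prod_symm, PartialEquiv.prod_coe, modelWithCornersSelf_prod,
      ← chartedSpaceSelf_prod]
    exact mfderiv_prodMap (mdifferentiableAt_extChartAt_symm hz.1)
      (mdifferentiableAt_extChartAt_symm hz.2)
  refine ContinuousLinearMap.ext fun v => ContinuousLinearMap.ext fun w => ?_
  have hp : (extChartAt (I.prod J) x).symm z =
      ((extChartAt I x.1).symm z.1, (extChartAt J x.2).symm z.2) := by
    rw [extChartAt_prod]; rfl
  have hA : ∀ u : E × E', (mfderiv 𝓘(ℝ, E × E') (I.prod J) (extChartAt (I.prod J) x).symm z u :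
      E × E') = (mfderiv 𝓘(ℝ, E) I (extChartAt I x.1).symm z.1 u.1,
        mfderiv 𝓘(ℝ, E') J (extChartAt J x.2).symm z.2 u.2) := fun u => DFunLike.congr_fun hm u
  refine (form_congr_base (I := I.prod J) (g := warpedMetric I J g h r) hp _ _).trans ?_
  refine (congrArg₂ (fun a b : E × E' => (warpedMetric I J g h r ((extChartAt I x.1).symm z.1,
    (extChartAt J x.2).symm z.2) : E × E' →L[ℝ] E × E' →L[ℝ] ℝ) a b) (hA v) (hA w)).trans ?_
  exact warpedMetric_apply g h r _ _ _

end WarpedCharts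

/-! ### A differential inequality along null directions -/

section Gronwall

open Filter

/-- A function that vanishes at `0` and satisfies `φ' ≤ K φ` cannot become positive immediately. -/
theorem false_of_hasDerivAt_le_mul {φ : ℝ → ℝ} {K : ℝ} (h0 : Tendsto φ (𝓝[>] 0) (𝓝 0))
    (hφ : ∀ᶠ t in 𝓝[>] (0 : ℝ), 0 < φ t ∧ ∃ d, HasDerivAt φ d t ∧ d ≤ K * φ t) : False := by
  obtain ⟨ε, hε, hε'⟩ := mem_nhdsGT_iff_exists_Ioo_subset.1 hφ
  have hε0 : (0 : ℝ) < ε := hε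
  set ψ : ℝ → ℝ := fun t => Real.exp (-K * t) * φ t with hψ
  have hd : ∀ t ∈ Ioo 0 ε, ∃ d, HasDerivAt ψ d t ∧ d ≤ 0 := by
    intro t ht
    obtain ⟨-, d, hd, hdle⟩ := hε' ht
    have h1 : HasDerivAt (fun t => Real.exp (-K * t)) (Real.exp (-K * t) * (-K * 1)) t :=
      ((hasDerivAt_id t).const_mul (-K)).exp
    refine ⟨_, h1.mul hd, ?_⟩
    have := Real.exp_pos (-K * t)
    nlinarith
  have hanti : AntitoneOn ψ (Ioo 0 ε) := by
    apply antitoneOn_of_deriv_nonpos (convex_Ioo 0 ε)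
    · intro t ht
      obtain ⟨d, hd, -⟩ := hd t ht
      exact hd.continuousAt.continuousWithinAt
    · intro t ht
      rw [interior_Ioo] at ht
      obtain ⟨d, hd, -⟩ := hd t ht
      exact hd.differentiableAt.differentiableWithinAt
    · intro t ht
      rw [interior_Ioo] at ht
      obtain ⟨d, hd, hle⟩ := hd t ht
      rwa [hd.deriv]
  have hψ0 : Tendsto ψ (𝓝[>] 0) (𝓝 0) := by
    have : Tendsto (fun t => Real.exp (-K * t)) (𝓝[>] 0) (𝓝 (Real.exp (-K * 0))) :=
      (Continuous.tendsto (by fun_prop) 0).mono_left nhdsWithin_le_nhds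
    simpa [hψ] using this.mul h0
  have hmid : ε / 2 ∈ Ioo 0 ε := ⟨by linarith, by linarith⟩
  have hpos : 0 < ψ (ε / 2) := mul_pos (Real.exp_pos _) (hε' hmid).1
  have hle : ψ (ε / 2) ≤ 0 := by
    refine ge_of_tendsto hψ0 ?_
    filter_upwards [Ioo_mem_nhdsGT hmid.1] with t ht
    exact hanti ⟨ht.1, ht.2.trans hmid.2⟩ hmid ht.2.le
  linarith

end Gronwall

namespace ChartMetric

open Filter

variable {E : Type*} [NormedAddCommGroup E] [NormedSpace ℝ E]

/-- A null vector extends to a null vector field: add the multiple of a fixed timelike vector `e`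
that solves the quadratic equation expressing nullity. -/
theorem IsMetricAt.exists_null_field {G : E → E →L[ℝ] E →L[ℝ] ℝ} {x : E} (hG : IsMetricAt G x)
    {e n₀ : E} (he : G x e e < 0) (hen : G x e n₀ < 0) (hn₀ : G x n₀ n₀ = 0) :
    ∃ n : E → E, ContDiffAt ℝ 1 n x ∧ n x = n₀ ∧ ∀ᶠ y in 𝓝 x, G y (n y) (n y) = 0 := by
  have hC : ∀ v w : E, ContDiffAt ℝ 2 (fun y => G y v w) x := fun v w =>
    (hG.contDiffAt.clm_apply contDiffAt_const).clm_apply contDiffAt_const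
  set disc : E → ℝ := fun y => G y e n₀ ^ 2 - G y e e * G y n₀ n₀ with hdisc
  have hd0 : disc x = G x e n₀ ^ 2 := by simp [hdisc, hn₀]
  have hdpos : 0 < disc x := by rw [hd0]; exact sq_pos_of_neg hen
  have hdC : ContDiffAt ℝ 2 disc x := ((hC e n₀).pow 2).sub ((hC e e).mul (hC n₀ n₀))
  refine ⟨fun y => n₀ + (-(G y e n₀ + √(disc y)) / G y e e) • e, ?_, ?_, ?_⟩
  · refine ContDiffAt.of_le (n := 2) ?_ (by norm_num)
    exact contDiffAt_const.add (((((hC e n₀).add (hdC.sqrt hdpos.ne')).neg).div (hC e e)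
      he.ne).smul contDiffAt_const)
  · simp only [hd0, Real.sqrt_sq_eq_abs, abs_of_neg hen]
    simp
  · filter_upwards [hdC.continuousAt.eventually (lt_mem_nhds hdpos),
      (hC e e).continuousAt.eventually (gt_mem_nhds he), hG.symm] with y h1 h2 h3
    have hs : √(disc y) ^ 2 = G y e n₀ ^ 2 - G y e e * G y n₀ n₀ := Real.sq_sqrt h1.le
    simp only [map_add, map_smul, add_apply, smul_apply, smul_eq_mul, h3 n₀ e]
    have hne := h2.ne
    field_simp
    linear_combination hs

theorem hess_add_smul_left (G : E → E →L[ℝ] E →L[ℝ] ℝ) (ρ : E → ℝ) (x : E) (a b : ℝ)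
    (v v' w : E) :
    hess G ρ x (a • v + b • v') w = a * hess G ρ x v w + b * hess G ρ x v' w := by
  simp [hess]
  ring

/-- The covariant derivative of a null vector field `n` on a surface is proportional to `n`. -/
theorem IsMetricAt.covariantDeriv_null (hE : Module.finrank ℝ E = 2)
    {G : E → E →L[ℝ] E →L[ℝ] ℝ} {x : E} (hG : IsMetricAt G x) {n : E → E}
    (hn : DifferentiableAt ℝ n x) (hnull : ∀ᶠ y in 𝓝 x, G y (n y) (n y) = 0) {l : E}
    (hl : G x l l = 0) (hnl : G x (n x) l ≠ 0) (v : E) :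
    fderiv ℝ n x v + christoffel G x v (n x) =
      (G x (fderiv ℝ n x v + christoffel G x v (n x)) l / G x (n x) l) • n x := by
  have h1 : HasFDerivAt (fun y => G y (n y) (n y)) _ x :=
    (hG.differentiableAt.hasFDerivAt.clm_apply hn.hasFDerivAt).clm_apply hn.hasFDerivAt
  have h2 : (fun y => G y (n y) (n y)) =ᶠ[𝓝 x] fun _ => (0 : ℝ) := hnull
  have h3 := DFunLike.congr_fun
    (((hasFDerivAt_const (0 : ℝ) x).congr_of_eventuallyEq h2).unique h1) v
  simp at h3
  rw [hG.fderiv_apply, hG.symm_self (n x) (fderiv ℝ n x v),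
    hG.symm_self (n x) (christoffel G x v (n x))] at h3
  have h4 : G x (fderiv ℝ n x v + christoffel G x v (n x)) (n x) = 0 := by
    rw [map_add, add_apply]
    linarith
  conv_lhs => rw [eq_add_of_null hE hG.symm_self hnull.self_of_nhds hl hnl
    (fderiv ℝ n x v + christoffel G x v (n x)), h4]
  simp

/-- The reflection of a null vector `n` in the direction of a timelike vector `e`. -/
def reflect (B : E →L[ℝ] E →L[ℝ] ℝ) (e n : E) : E := (2 * (B e n / B e e)) • e - n

section Reflect

variable {B : E →L[ℝ] E →L[ℝ] ℝ} {e n : E}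

theorem reflect_null (hB : ∀ v w, B v w = B w v) (he : B e e ≠ 0) (hn : B n n = 0) :
    B (reflect B e n) (reflect B e n) = 0 := by
  simp only [reflect, map_sub, map_smul, sub_apply, smul_apply, smul_eq_mul, hn, hB n e]
  field_simp
  ring

theorem apply_reflect_neg (hB : ∀ v w, B v w = B w v) (he : B e e < 0)
    (hen : B e n < 0) (hn : B n n = 0) :
    B n (reflect B e n) < 0 := by
  have : B n (reflect B e n) = 2 * B e n ^ 2 / B e e := by
    simp only [reflect, map_sub, map_smul, smul_eq_mul, hn, hB n e]
    field_simp [he.ne]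
    ring
  rw [this]
  exact div_neg_of_pos_of_neg (mul_pos two_pos (sq_pos_of_neg hen)) he

theorem apply_reflect_timelike (he : B e e ≠ 0) : B e (reflect B e n) = B e n := by
  simp only [reflect, map_sub, map_smul, smul_eq_mul]
  field_simp
  ring

/-- A null vector on the same side of the timelike direction `W` and of the spacelike direction `v`
as `n` is a positive multiple of `n`. -/
theorem exists_eq_smul_of_null (hB : ∀ v w, B v w = B w v)
    (hE : Module.finrank ℝ E = 2) {l N W v : E} (hn : B n n = 0)
    (hl : B l l = 0) (hnl : B n l < 0) (hN : B N N = 0) (hWn : B W n < 0) (hWl : B W l < 0)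
    (hWN : B W N < 0) (hvl : B v l < 0) (hvN : 0 < B v N) : ∃ p : ℝ, 0 < p ∧ N = p • n := by
  have hdec := eq_add_of_null hE hB hn hl hnl.ne N
  set p := B N l / B n l
  set q := B N n / B n l
  rw [hdec] at hN hWN hvN
  simp only [map_add, map_smul, add_apply, smul_apply, smul_eq_mul, hn, hl, hB l n]
    at hN hWN hvN
  have hpq : p * q = 0 := by
    have : (p * q) * (2 * B n l) = 0 := by linarith
    exact (mul_eq_zero.1 this).resolve_right (by linarith)
  rcases mul_eq_zero.1 hpq with h | h
  · rw [h, zero_mul, zero_add] at hWN hvN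
    nlinarith [(neg_iff_neg_of_mul_pos hvN).2 hvl]
  · rw [h, zero_mul, add_zero] at hWN
    refine ⟨p, by by_contra! hp; nlinarith, ?_⟩
    rw [h, zero_smul, add_zero] at hdec
    exact hdec

/-- If `v` is spacelike, then the two null directions lie on opposite sides of it. -/
theorem apply_neg_of_spacelike (hB : ∀ v w, B v w = B w v)
    (hE : Module.finrank ℝ E = 2) {l v : E} (hn : B n n = 0)
    (hl : B l l = 0) (hnl : B n l < 0) (hv : 0 < B v v) (hvn : 0 < B v n) : B v l < 0 := by
  have h1 := congrArg (B v) (eq_add_of_null hE hB hn hl hnl.ne v)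
  simp only [map_add, map_smul, smul_eq_mul] at h1
  have h2 : B v v * B n l = 2 * B v n * B v l := by
    rw [h1]
    field_simp [hnl.ne]
    ring
  nlinarith [mul_neg_of_pos_of_neg hv hnl]

end Reflect

/-- The coefficient in the differential inequality satisfied by `n(ρ)` along a curve with
velocity `v`, where `l` is a second null vector and `a` stands for the covariant derivative
`∇_v n`. -/
def nullCoeff (G : E → E →L[ℝ] E →L[ℝ] ℝ) (ρ : E → ℝ) (k : ℝ) (x v n a l : E) : ℝ :=
  -(G x v n / G x n l) * (k * fderiv ℝ ρ x l / ρ x) + G x a l / G x n l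

/-- The left-hand side is the derivative of `n(ρ)` along a curve with velocity `v`. It equals
`Hess(v, n) + (∇_v n)(ρ)`. The second summand is a multiple of `n(ρ)`; the first one is bounded by a
multiple of `n(ρ)` because `v = a n - b l` with `a, b > 0`. -/
theorem IsMetricAt.deriv_null_le [CompleteSpace E] (hE : Module.finrank ℝ E = 2)
    {G : E → E →L[ℝ] E →L[ℝ] ℝ} {ρ : E → ℝ} {k : ℝ} {x : E} (hG : IsMetricAt G x)
    (hρ : ContDiffAt ℝ 2 ρ x) (hρ0 : 0 < ρ x) {n : E → E} (hn : DifferentiableAt ℝ n x)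
    (hnull : ∀ᶠ y in 𝓝 x, G y (n y) (n y) = 0) {l v : E} (hl : G x l l = 0)
    (hnl : G x (n x) l < 0) (hvn : 0 < G x v (n x)) (hvl : G x v l < 0)
    (h1 : hess G ρ x (n x) (n x) ≤ 0)
    (h2 : 0 ≤ ρ x * hess G ρ x (n x) l + k * fderiv ℝ ρ x (n x) * fderiv ℝ ρ x l) :
    fderiv ℝ (fderiv ℝ ρ) x v (n x) + fderiv ℝ ρ x (fderiv ℝ n x v) ≤
      nullCoeff G ρ k x v (n x) (fderiv ℝ n x v + christoffel G x v (n x)) l *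
        fderiv ℝ ρ x (n x) := by
  have hnn := hnull.self_of_nhds
  have e1 : fderiv ℝ (fderiv ℝ ρ) x v (n x) + fderiv ℝ ρ x (fderiv ℝ n x v) =
      hess G ρ x v (n x) + fderiv ℝ ρ x (fderiv ℝ n x v + christoffel G x v (n x)) := by
    rw [hess, map_add]
    ring
  have e2 : fderiv ℝ ρ x (fderiv ℝ n x v + christoffel G x v (n x)) =
      G x (fderiv ℝ n x v + christoffel G x v (n x)) l / G x (n x) l * fderiv ℝ ρ x (n x) := by
    conv_lhs => rw [hG.covariantDeriv_null hE hn hnull hl hnl.ne]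
    rw [map_smul, smul_eq_mul]
  have e3 : hess G ρ x v (n x) = G x v l / G x (n x) l * hess G ρ x (n x) (n x) +
      G x v (n x) / G x (n x) l * hess G ρ x (n x) l := by
    rw [hG.hess_symm hρ (n x) l, ← hess_add_smul_left,
      ← eq_add_of_null hE hG.symm_self hnn hl hnl.ne v]
  have ha : 0 < G x v l / G x (n x) l := div_pos_of_neg_of_neg hvl hnl
  have hb : G x v (n x) / G x (n x) l < 0 := div_neg_of_pos_of_neg hvn hnl
  have h3 : -(k * fderiv ℝ ρ x l / ρ x) * fderiv ℝ ρ x (n x) ≤ hess G ρ x (n x) l := by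
    rw [neg_mul, div_mul_eq_mul_div, neg_le_iff_add_nonneg, ← mul_nonneg_iff_of_pos_left hρ0,
      mul_add, mul_div_cancel₀ _ hρ0.ne']
    linarith
  have h4 := mul_nonpos_of_nonneg_of_nonpos ha.le h1
  have h5 := mul_le_mul_of_nonpos_left h3 hb.le
  rw [e1, e2, e3, nullCoeff, add_mul]
  linarith

theorem tendsto_clm_apply {V W : Type*} [NormedAddCommGroup V] [NormedSpace ℝ V]
    [NormedAddCommGroup W] [NormedSpace ℝ W] {α : Type*} {a : Filter α} {f : α → V →L[ℝ] W}
    {f₀ : V →L[ℝ] W} {v : α → V} {v₀ : V} (hf : Tendsto f a (𝓝 f₀)) (hv : Tendsto v a (𝓝 v₀)) :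
    Tendsto (fun t => f t (v t)) a (𝓝 (f₀ v₀)) :=
  (isBoundedBilinearMap_apply.continuous.tendsto (f₀, v₀)).comp (hf.prodMk_nhds hv)

/-- Let `c` be a spacelike curve with velocity `c'` in a surface, and let `N` be a null vector field
along `c` with `G(c', N) > 0`, future-directed with respect to the timelike field `W`. Suppose that
near `c 0` the Hessian of `ρ` is nonpositive on null vectors and satisfies the lower bound
`ρ Hess(n, l) + k n(ρ) l(ρ) ≥ 0` on pairs of null vectors with `G(n, l) < 0`. Then `N(ρ)` cannot
vanish at time `0` and be positive immediately afterwards. No regularity of `N` is required, since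
`N` is at each time a positive multiple of a smooth null field `n`. Here `v₀`, `e` and `n₀` are the
values at time `0` of `c'`, `W` and `N`. -/
theorem false_of_null_deriv_pos [FiniteDimensional ℝ E] (hE : Module.finrank ℝ E = 2)
    {G : E → E →L[ℝ] E →L[ℝ] ℝ} {ρ : E → ℝ} {k : ℝ} {c c' N W : ℝ → E} {v₀ e n₀ : E}
    (hG : IsMetricAt G (c 0)) (hρ : ContDiffAt ℝ 2 ρ (c 0)) (hρ0 : 0 < ρ (c 0))
    (hhess : ∀ᶠ y in 𝓝 (c 0), ∀ n l, G y n n = 0 → G y l l = 0 → G y n l < 0 →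
      hess G ρ y n n ≤ 0 ∧ 0 ≤ ρ y * hess G ρ y n l + k * fderiv ℝ ρ y n * fderiv ℝ ρ y l)
    (hc0 : Tendsto c (𝓝[>] 0) (𝓝 (c 0))) (hc' : Tendsto c' (𝓝[>] 0) (𝓝 v₀))
    (hc : ∀ᶠ t in 𝓝[>] (0 : ℝ), HasDerivAt c (c' t) t) (hW : Tendsto W (𝓝[>] 0) (𝓝 e))
    (he : G (c 0) e e < 0) (hen : G (c 0) e n₀ < 0) (hn₀ : G (c 0) n₀ n₀ = 0)
    (hv₀ : 0 < G (c 0) v₀ v₀) (hvn : 0 < G (c 0) v₀ n₀) (hρn : fderiv ℝ ρ (c 0) n₀ = 0)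
    (hN : ∀ᶠ t in 𝓝[>] (0 : ℝ), G (c t) (N t) (N t) = 0 ∧ G (c t) (W t) (N t) < 0 ∧
      0 < G (c t) (c' t) (N t) ∧ 0 < fderiv ℝ ρ (c t) (N t)) : False := by
  obtain ⟨n, hnC, hnx, hnull⟩ := hG.exists_null_field he hen hn₀
  -- The second null direction, future-directed as well.
  set l : E → E := fun y => reflect (G y) e (n y) with hl
  have hGt : Tendsto (fun t => G (c t)) (𝓝[>] 0) (𝓝 (G (c 0))) :=
    hG.contDiffAt.continuousAt.tendsto.comp hc0
  have hnt : Tendsto (fun t => n (c t)) (𝓝[>] 0) (𝓝 n₀) := by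
    rw [← hnx]; exact hnC.continuousAt.tendsto.comp hc0
  have ev : ∀ {f f' : ℝ → E} {a a' : E}, Tendsto f (𝓝[>] 0) (𝓝 a) → Tendsto f' (𝓝[>] 0) (𝓝 a') →
      Tendsto (fun t => G (c t) (f t) (f' t)) (𝓝[>] 0) (𝓝 (G (c 0) a a')) := fun h h' =>
    tendsto_clm_apply (tendsto_clm_apply hGt h) h'
  set l₀ : E := reflect (G (c 0)) e n₀ with hl₀
  have he' : Tendsto (fun _ : ℝ => e) (𝓝[>] 0) (𝓝 e) := tendsto_const_nhds
  have hlt : Tendsto (fun t => l (c t)) (𝓝[>] 0) (𝓝 l₀) :=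
    ((((ev he' hnt).div (ev he' he') he.ne).const_mul 2).smul he').sub hnt
  have hel₀ : G (c 0) e l₀ < 0 := by rwa [hl₀, apply_reflect_timelike he.ne]
  have hnl₀ : G (c 0) n₀ l₀ < 0 := apply_reflect_neg hG.symm_self he hen hn₀
  have hl₀l₀ : G (c 0) l₀ l₀ = 0 := reflect_null hG.symm_self he.ne hn₀
  have hvl₀ : G (c 0) v₀ l₀ < 0 :=
    apply_neg_of_spacelike hG.symm_self hE hn₀ hl₀l₀ hnl₀ hv₀ hvn
  have hDρ : Tendsto (fun t => fderiv ℝ ρ (c t)) (𝓝[>] 0) (𝓝 (fderiv ℝ ρ (c 0))) :=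
    (hρ.fderiv_right (m := 1) (by norm_num)).continuousAt.tendsto.comp hc0
  have hρt : Tendsto (fun t => ρ (c t)) (𝓝[>] 0) (𝓝 (ρ (c 0))) :=
    hρ.continuousAt.tendsto.comp hc0
  have hDn : Tendsto (fun t => fderiv ℝ n (c t)) (𝓝[>] 0) (𝓝 (fderiv ℝ n (c 0))) :=
    (hnC.fderiv_right (m := 0) (by norm_num)).continuousAt.tendsto.comp hc0
  have hΓ : Tendsto (fun t => christoffel G (c t)) (𝓝[>] 0) (𝓝 (christoffel G (c 0))) :=
    hG.contDiffAt_christoffel.continuousAt.tendsto.comp hc0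
  have hcov := (tendsto_clm_apply hDn hc').add (tendsto_clm_apply (tendsto_clm_apply hΓ hc') hnt)
  have hKt : Tendsto (fun t => nullCoeff G ρ k (c t) (c' t) (n (c t))
      (fderiv ℝ n (c t) (c' t) + christoffel G (c t) (c' t) (n (c t))) (l (c t))) (𝓝[>] 0) _ :=
    ((((ev hc' hnt).div (ev hnt hlt) hnl₀.ne).neg).mul
      (((tendsto_clm_apply hDρ hlt).const_mul k).div hρt hρ0.ne')).add
        ((ev hcov hlt).div (ev hnt hlt) hnl₀.ne)
  have hφt : Tendsto (fun t => fderiv ℝ ρ (c t) (n (c t))) (𝓝[>] 0) (𝓝 0) := by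
    simpa only [hρn] using tendsto_clm_apply hDρ hnt
  obtain ⟨K₀, hK₀⟩ := hKt.isBoundedUnder_le
  rw [eventually_map] at hK₀
  refine false_of_hasDerivAt_le_mul (K := K₀) hφt ?_
  -- All strict inequalities that hold at time `0` persist for small times.
  filter_upwards [hK₀, hc, hN, hc0.eventually hhess, hc0.eventually hG.eventually,
    hc0.eventually (hρ.eventually (by simp)), hc0.eventually (hnC.eventually (by simp)),
    hc0.eventually hnull.eventually_nhds, (ev he' he').eventually (gt_mem_nhds he),
    hρt.eventually (lt_mem_nhds hρ0), (ev hnt hlt).eventually (gt_mem_nhds hnl₀),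
    (ev hc' hnt).eventually (lt_mem_nhds hvn), (ev hc' hlt).eventually (gt_mem_nhds hvl₀),
    (ev hW hnt).eventually (gt_mem_nhds hen), (ev hW hlt).eventually (gt_mem_nhds hel₀)]
    with t hKt hct ⟨hNN, hWN, hcN, hρN⟩ hht hGt hρC hnCt hnullt het hρt hnlt hcn hcl hWn hWl
  have hnn := hnullt.self_of_nhds
  have hllt : G (c t) (l (c t)) (l (c t)) = 0 := reflect_null hGt.symm_self het.ne hnn
  have hpos : 0 < fderiv ℝ ρ (c t) (n (c t)) := by
    obtain ⟨p, hp, hNp⟩ := exists_eq_smul_of_null hGt.symm_self hE hnn hllt hnlt hNN hWn hWl hWN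
      hcl hcN
    rw [hNp, map_smul, smul_eq_mul] at hρN
    exact (pos_iff_pos_of_mul_pos hρN).1 hp
  have hn1 := hnCt.differentiableAt (by simp)
  obtain ⟨h1, h2⟩ := hht _ _ hnn hllt hnlt
  refine ⟨hpos, _, (((hρC.fderiv_right (m := 1) (by norm_num)).differentiableAt
    (by simp)).hasFDerivAt.comp_hasDerivAt t hct).clm_apply
      (hn1.hasFDerivAt.comp_hasDerivAt t hct), ?_⟩
  exact (hGt.deriv_null_le hE hρC hρt hn1 hnullt hllt hnlt hcn hcl h1 h2).trans
    (mul_le_mul_of_nonneg_right hKt hpos.le)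

end ChartMetric

/-! ### Energy condition and Hessian -/

section EnergyCondition

theorem LorentzianMetric.eq_zero_of_inner_eq_zero {E : Type*} [NormedAddCommGroup E]
    [NormedSpace ℝ E] {H : Type*} [TopologicalSpace H] {I : ModelWithCorners ℝ E H}
    {M : Type*} [TopologicalSpace M] [ChartedSpace H M] [IsManifold I ∞ M]
    (g : LorentzianMetric I M) (x : M) (v : TangentSpace I x) (hv : ∀ w, g.inner x v w = 0) :
    v = 0 := by
  by_contra hv0
  obtain ⟨t, ht⟩ := g.exists_timelike x
  have h := g.pos_of_orthogonal x t v ht (by rw [g.symm, hv]) hv0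
  rw [hv] at h
  exact lt_irrefl _ h

variable {E : Type*} [NormedAddCommGroup E] [NormedSpace ℝ E]
  {H : Type*} [TopologicalSpace H] {I : ModelWithCorners ℝ E H}
  {Q : Type*} [TopologicalSpace Q] [ChartedSpace H Q] [IsManifold I ∞ Q]
  (g : LorentzianMetric I Q) {r : Q → ℝ}

/-- A continuous vector field has continuous components in a chart. -/
theorem continuousAt_mfderiv_extChartAt {X : ∀ x : Q, TangentSpace I x}
    (hX : Continuous (fun x ↦ (⟨x, X x⟩ : TangentBundle I Q))) (x : Q) :
    ContinuousAt (fun y => (mfderiv I 𝓘(ℝ, E) (extChartAt I x) y (X y) : E)) x := by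
  have hM : IsManifold I 1 Q := .of_le (n := ∞) (by simp)
  have h := ((FiberBundle.continuousAt_totalSpace E
    (fun x ↦ (⟨x, X x⟩ : TangentBundle I Q))).1 (hX.continuousAt (x := x))).2
  refine h.congr ?_
  filter_upwards [(chartAt H x).open_source.mem_nhds (mem_chart_source H x)] with y hy
  rw [← TangentBundle.continuousLinearMapAt_trivializationAt hy]
  exact ((trivializationAt E (TangentSpace I) x).continuousLinearMapAt_apply_of_mem ℝ
    (by simpa using hy) (X y)).symm

variable [I.Boundaryless]

theorem dirDeriv_eq_fderiv (hr : ContMDiff I 𝓘(ℝ, ℝ) ∞ r) {x y : Q}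
    (hy : y ∈ (extChartAt I x).source) (v : TangentSpace I y) :
    dirDeriv I r v = fderiv ℝ (r ∘ (extChartAt I x).symm) (extChartAt I x y)
      (mfderiv I 𝓘(ℝ, E) (extChartAt I x) y v) := by
  have h1 : MDifferentiableAt 𝓘(ℝ, E) I (extChartAt I x).symm (extChartAt I x y) :=
    mdifferentiableAt_extChartAt_symm ((extChartAt I x).map_source hy)
  have h2 : MDifferentiableAt I 𝓘(ℝ, ℝ) r ((extChartAt I x).symm (extChartAt I x y)) :=
    hr.mdifferentiable (by simp) _
  rw [← mfderiv_eq_fderiv, mfderiv_comp _ h2 h1]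
  have h3 := mfderiv_extChartAt_symm_apply hy v
  have h4 := (extChartAt I x).left_inv hy
  refine Eq.trans ?_ (congrArg (fun u : E => (mfderiv I 𝓘(ℝ, ℝ) r
    ((extChartAt I x).symm (extChartAt I x y)) : E →L[ℝ] ℝ) u) h3).symm
  rw [h4]
  rfl

variable [FiniteDimensional ℝ E]

/-- The chart expression of a Lorentzian metric is a pseudo-Riemannian metric on the chart
domain. -/
theorem LorentzianMetric.isMetricAt (x : Q) {y : E} (hy : y ∈ (extChartAt I x).target) :
    ChartMetric.IsMetricAt (metricInChart I g.inner x) y :=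
  isMetricAt_metricInChart g.contMDiff g.symm g.eq_zero_of_inner_eq_zero x hy

/-- The chart expressions of the metric, of the differential and of the Hessian of `r` at `x` in the
preferred charts at `x` and at `x₀` agree up to one and the same surjective linear map `A`, the
derivative of the change of coordinates. -/
theorem hess_metricInChart (hr : ContMDiff I 𝓘(ℝ, ℝ) ∞ r) {x₀ x : Q}
    (hx : x ∈ (extChartAt I x₀).source) :
    ∃ A : E →L[ℝ] E, Function.Surjective A ∧
      (∀ v w, metricInChart I g.inner x (extChartAt I x x) v w =
        metricInChart I g.inner x₀ (extChartAt I x₀ x) (A v) (A w)) ∧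
      (∀ v, fderiv ℝ (r ∘ (extChartAt I x).symm) (extChartAt I x x) v =
        fderiv ℝ (r ∘ (extChartAt I x₀).symm) (extChartAt I x₀ x) (A v)) ∧
      ∀ v w, ChartMetric.hess (metricInChart I g.inner x) (r ∘ (extChartAt I x).symm)
          (extChartAt I x x) v w =
        ChartMetric.hess (metricInChart I g.inner x₀) (r ∘ (extChartAt I x₀).symm)
          (extChartAt I x₀ x) (A v) (A w) := by
  set τ := extChartAt I x₀ ∘ (extChartAt I x).symm with hτdef
  set p := extChartAt I x x with hp
  have hτp : τ p = extChartAt I x₀ x := by simp [hτdef, hp]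
  have hG : ChartMetric.IsMetricAt (metricInChart I g.inner x₀) (τ p) := by
    rw [hτp]; exact g.isMetricAt x₀ ((extChartAt I x₀).map_source hx)
  have hρ : ContDiffAt ℝ 2 (r ∘ (extChartAt I x₀).symm) (τ p) := by
    rw [hτp]; exact contDiffAt_comp_extChartAt_symm hr x₀ ((extChartAt I x₀).map_source hx)
  have hτ : ContDiffAt ℝ 2 τ p := contDiffAt_extChartAt_comp_symm hx
  have hev := metricInChart_eventuallyEq_pullbackForm (g := g.inner) hx
  have hG₁ := g.isMetricAt x (mem_extChartAt_target x)
  have hG' := hG₁.congr hev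
  have happ : ∀ v w, metricInChart I g.inner x p v w =
      metricInChart I g.inner x₀ (τ p) (fderiv ℝ τ p v) (fderiv ℝ τ p w) := by
    intro v w
    rw [hev.eq_of_nhds]
    rfl
  have hsurj : Function.Surjective (fderiv ℝ τ p) := by
    refine (LinearMap.injective_iff_surjective (f := (fderiv ℝ τ p).toLinearMap)).1 ?_
    rw [← LinearMap.ker_eq_bot, LinearMap.ker_eq_bot']
    intro v hv
    apply hG₁.isInvertible.injective
    ext w
    have hv' : fderiv ℝ τ p v = 0 := hv
    rw [happ, hv']
    simp
  have hρev := comp_extChartAt_symm_eventuallyEq r hx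
  refine ⟨fderiv ℝ τ p, hsurj, ?_, ?_, ?_⟩
  · rwa [← hτp]
  · intro v
    rw [hρev.fderiv_eq, ← hτp]
    rw [fderiv_comp p (hρ.differentiableAt (by simp)) (hτ.differentiableAt (by simp))]
    rfl
  · intro v w
    rw [← hτp, ChartMetric.hess_congr hev hρev]
    exact hG.hess_pullback hρ hτ hG' hsurj v w

variable {E' : Type*} [NormedAddCommGroup E'] [NormedSpace ℝ E'] [FiniteDimensional ℝ E']
  {H' : Type*} [TopologicalSpace H'] {J : ModelWithCorners ℝ E' H'} [J.Boundaryless]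
  {F : Type*} [TopologicalSpace F] [ChartedSpace H' F] [IsManifold J ∞ F]
  {h : ∀ f : F, TangentSpace J f →L[ℝ] TangentSpace J f →L[ℝ] ℝ}

/-- If the fiber has nonpositive scalar curvature at some point, the dominant energy condition
bounds the null components of the Hessian of the warping function: it is the nonnegativity of the
Einstein tensor on the pairs `(n, n)` (by approximation) and `(n, l)`. -/
theorem hess_le_of_dominantEnergyCondition (hE : Module.finrank ℝ E = 2)
    (hE' : 0 < Module.finrank ℝ E') (hr : ContMDiff I 𝓘(ℝ, ℝ) ∞ r) (hr0 : ∀ q, 0 < r q)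
    (hdec : DominantEnergyCondition (I.prod J) (warpedMetric I J g.inner h r))
    (hh : ∀ f, ChartMetric.IsMetricAt (metricInChart J h f) (extChartAt J f f))
    {f : F} (hf : scalarCurvature J h f ≤ 0) (x : Q) {n l : E}
    (hn : metricInChart I g.inner x (extChartAt I x x) n n = 0)
    (hl : metricInChart I g.inner x (extChartAt I x x) l l = 0)
    (hnl : metricInChart I g.inner x (extChartAt I x x) n l < 0) :
    ChartMetric.hess (metricInChart I g.inner x) (r ∘ (extChartAt I x).symm)
        (extChartAt I x x) n n ≤ 0 ∧
      0 ≤ r x * ChartMetric.hess (metricInChart I g.inner x) (r ∘ (extChartAt I x).symm)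
        (extChartAt I x x) n l + (Module.finrank ℝ E' - 1) *
          fderiv ℝ (r ∘ (extChartAt I x).symm) (extChartAt I x x) n *
            fderiv ℝ (r ∘ (extChartAt I x).symm) (extChartAt I x x) l := by
  set G := metricInChart I g.inner x with hGdef
  set ρ := r ∘ (extChartAt I x).symm with hρdef
  set p := extChartAt I x x with hp
  set k : E' → E' →L[ℝ] E' →L[ℝ] ℝ := metricInChart J h f
  set q := extChartAt J f f
  have hpq : extChartAt (I.prod J) (x, f) (x, f) = (p, q) := by rw [extChartAt_prod]; rfl
  have hG : ChartMetric.IsMetricAt G (p, q).1 := g.isMetricAt x (mem_extChartAt_target x)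
  have hk : ChartMetric.IsMetricAt k (p, q).2 := hh f
  have hρ : ContDiffAt ℝ 2 ρ (p, q).1 :=
    contDiffAt_comp_extChartAt_symm hr x (mem_extChartAt_target x)
  have hρp : ρ p = r x := by simp [hρdef, hp]
  have hρ0 : 0 < ρ p := by rw [hρp]; exact hr0 x
  have hev := metricInChart_warpedMetric g.inner h r (x, f)
  have dec : ∀ v w : E, v ≠ 0 → w ≠ 0 → G p v v ≤ 0 → G p w w ≤ 0 → G p v w < 0 →
      0 ≤ ChartMetric.einstein (ChartMetric.warped G k ρ) (p, q) (v, 0) (w, 0) := by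
    intro v w hv0 hw0 hv hw hvw
    have key := hdec.einstein_nonneg (x, f) (v := (v, 0)) (w := (w, 0))
      (fun h => hv0 (congrArg Prod.fst h)) (fun h => hw0 (congrArg Prod.fst h))
    rw [ChartMetric.einstein_congr hev, hev.eq_of_nhds, hpq] at key
    refine key ?_ ?_ ?_ <;> simpa [ChartMetric.warped_apply]
  have hnl' : G p l n < 0 := by rwa [← hG.symm_self n l]
  have hn0 : n ≠ 0 := by rintro rfl; simp at hnl
  have hl0 : l ≠ 0 := by rintro rfl; simp at hnl
  set c := ChartMetric.einstein (ChartMetric.warped G k ρ) (p, q) (n, 0) (l, 0)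
  have hc1 : 0 ≤ c := dec n l hn0 hl0 hn.le hl.le hnl
  have hc2 := dec l n hl0 hn0 hl.le hn.le hnl'
  have hdim : (0 : ℝ) < Module.finrank ℝ E' := by exact_mod_cast hE'
  rw [← hρp]
  refine ⟨?_, ?_⟩
  · -- The energy condition does not apply to `(n, n)` itself, since `g(n, n) = 0`; apply it to
    -- `(n, n + ε l)` and let `ε` tend to `0`.
    have hlim : ∀ ε : ℝ, 0 < ε →
        0 ≤ ChartMetric.einstein (ChartMetric.warped G k ρ) (p, q) (n, 0) (n, 0) + ε * c := by
      intro ε hε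
      have h1 : G p n (n + ε • l) < 0 := by
        simp only [map_add, map_smul, hn, smul_eq_mul, zero_add]
        exact mul_neg_of_pos_of_neg hε hnl
      have h2 : G p (n + ε • l) (n + ε • l) ≤ 0 := by
        simp only [map_add, map_smul, add_apply, smul_apply, hn, hl, smul_eq_mul]
        nlinarith
      have h3 := dec n (n + ε • l) hn0 (by intro h; rw [h] at h1; simp at h1) hn.le h2 h1
      have h4 : ((n + ε • l, 0) : E × E') = (n, 0) + ε • (l, 0) := by simp
      rw [h4] at h3
      convert h3 using 1
      simp only [c, ChartMetric.einstein, map_add, map_smul, smul_eq_mul]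
      ring
    rw [ChartMetric.einstein_warped_null hE hG hk hρ hρ0.ne' hn hl hnl.ne] at hlim
    by_contra! hpos
    have hX : 0 < Module.finrank ℝ E' * ChartMetric.hess G ρ p n n / ρ p := by positivity
    set X := Module.finrank ℝ E' * ChartMetric.hess G ρ p n n / ρ p
    have h5 := hlim (X / (2 * (c + 1))) (by positivity)
    have h6 : X / (2 * (c + 1)) * c ≤ X / 2 := by
      rw [div_mul_eq_mul_div, div_le_div_iff₀ (by positivity) two_pos]
      nlinarith
    linarith
  · -- Adding the two orders of the arguments avoids the symmetry of the Ricci tensor.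
    have h1 := ChartMetric.einstein_warped_add hE hG hk hρ hρ0.ne' hn hl hnl.ne
    have h2 := add_nonneg hc1 hc2
    rw [h1, neg_div, neg_nonneg, div_le_iff₀ (by positivity), zero_mul] at h2
    have h3 : 0 ≤ G p n l * ChartMetric.scalar k q := mul_nonneg_of_nonpos_of_nonpos hnl.le hf
    by_contra! hneg
    have h4 := mul_neg_of_pos_of_neg hdim hneg
    linarith

end EnergyCondition

end

/-! ### Positivity of the scalar curvature of the fiber -/

theorem corollary4p4 (n : ℕ) (hn : 2 ≤ n)
    (Q : Type*) [TopologicalSpace Q] [ChartedSpace (EuclideanSpace ℝ (Fin 2)) Q]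
    [IsManifold (𝓡 2) ∞ Q] (hQ : Nonempty (Q ≃ₜ EuclideanSpace ℝ (Fin 2)))
    (F : Type*) [TopologicalSpace F] [ChartedSpace (EuclideanSpace ℝ (Fin n)) F]
    [IsManifold (𝓡 n) ∞ F] [ConnectedSpace F]
    (g : LorentzianMetric (𝓡 2) Q) (T : TimeOrientation g)
    (h : ContMDiffRiemannianMetric (𝓡 n) ∞ (EuclideanSpace ℝ (Fin n))
      (fun f : F ↦ TangentSpace (𝓡 n) f))
    (r : Q → ℝ) (hr : ContMDiff (𝓡 2) 𝓘(ℝ, ℝ) ∞ r) (hr_pos : ∀ q, 0 < r q)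
    (hdec : DominantEnergyCondition ((𝓡 2).prod (𝓡 n))
      (warpedMetric (𝓡 2) (𝓡 n) g.inner h.inner r))
    (σ : ℝ → Q) (hσ : ContMDiffOn 𝓘(ℝ, ℝ) (𝓡 2) 1 σ (Icc 0 1))
    (hσ_spacelike : ∀ t ∈ Icc (0 : ℝ) 1,
      0 < g.inner (σ t) (curveVelocity (𝓡 2) σ t) (curveVelocity (𝓡 2) σ t))
    (L N : ∀ t : ℝ, TangentSpace (𝓡 2) (σ t))
    (hL : ∀ t ∈ Icc (0 : ℝ) 1, T.IsFutureNull (L t))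
    (hN : ∀ t ∈ Icc (0 : ℝ) 1, T.IsFutureNull (N t))
    (hLN : ∀ t ∈ Icc (0 : ℝ) 1, LinearIndependent ℝ ![L t, N t])
    (hσN : ∀ t ∈ Icc (0 : ℝ) 1, 0 < g.inner (σ t) (curveVelocity (𝓡 2) σ t) (N t))
    (hσL : ∀ t ∈ Icc (0 : ℝ) 1, g.inner (σ t) (curveVelocity (𝓡 2) σ t) (L t) < 0)
    (hN_zero : dirDeriv (𝓡 2) r (N 0) = 0)
    (hN_pos : ∀ t ∈ Ioc (0 : ℝ) 1, 0 < dirDeriv (𝓡 2) r (N t)) :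
    ∀ f : F, 0 < scalarCurvature (𝓡 n) h.inner f := by
  intro f
  by_contra! hf
  have hM : IsManifold (𝓡 2) 1 Q := .of_le (n := ∞) (by simp)
  have hE : Module.finrank ℝ (EuclideanSpace ℝ (Fin 2)) = 2 := by simp
  have hE' : 0 < Module.finrank ℝ (EuclideanSpace ℝ (Fin n)) := by simp; omega
  set x₀ := σ 0 with hx₀
  set φ := extChartAt (𝓡 2) x₀ with hφ
  set G := metricInChart (𝓡 2) g.inner x₀ with hG
  set ρ := r ∘ φ.symm with hρ
  have hxs : x₀ ∈ φ.source := mem_extChartAt_source x₀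
  have h0mem : (0 : ℝ) ∈ Icc (0 : ℝ) 1 := ⟨le_rfl, zero_le_one⟩
  have hh : ∀ f : F, ChartMetric.IsMetricAt (metricInChart (𝓡 n) h.inner f)
      (extChartAt (𝓡 n) f f) := fun f =>
    isMetricAt_metricInChart h.contMDiff h.symm
      (fun x v hv => by_contra fun hv0 => (h.pos x v hv0).ne' (hv v)) f (mem_extChartAt_target f)
  have hIoo : Ioo (0 : ℝ) 1 ∈ 𝓝[>] (0 : ℝ) := Ioo_mem_nhdsGT one_pos
  have hIcc_le : 𝓝[>] (0 : ℝ) ≤ 𝓝[Icc 0 1] 0 := by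
    rw [← nhdsWithin_Ioo_eq_nhdsGT (one_pos : (0 : ℝ) < 1)]
    exact nhdsWithin_mono _ Ioo_subset_Icc_self
  have hσc : Filter.Tendsto σ (𝓝[>] 0) (𝓝 x₀) :=
    ((hσ.continuousOn 0 h0mem).tendsto).mono_left hIcc_le
  have hsrc : ∀ᶠ t in 𝓝[>] (0 : ℝ), σ t ∈ φ.source :=
    hσc.eventually ((isOpen_extChartAt_source x₀).mem_nhds hxs)
  -- The curve in the chart and its velocity.
  set c : ℝ → EuclideanSpace ℝ (Fin 2) := fun t => φ (σ t) with hc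
  set c' : ℝ → EuclideanSpace ℝ (Fin 2) := fun t =>
    mfderiv (𝓡 2) 𝓘(ℝ, EuclideanSpace ℝ (Fin 2)) φ (σ t) (curveVelocity (𝓡 2) σ t) with hc'
  -- At interior times the velocity is an ordinary derivative; writing it with `fderivWithin` also
  -- gives its continuity at time `0`.
  have hc'eq : ∀ t ∈ Icc (0 : ℝ) 1, σ t ∈ φ.source →
      c' t = fderivWithin ℝ c (Icc 0 1) t 1 := by
    intro t ht hts
    have h1 : MDifferentiableAt (𝓡 2) 𝓘(ℝ, EuclideanSpace ℝ (Fin 2)) φ (σ t) :=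
      mdifferentiableAt_extChartAt (by rwa [← extChartAt_source (I := 𝓡 2)])
    have h2 : MDifferentiableWithinAt 𝓘(ℝ, ℝ) (𝓡 2) σ (Icc 0 1) t :=
      (hσ t ht).mdifferentiableWithinAt (by simp)
    rw [← mfderivWithin_eq_fderivWithin]
    have h3 := mfderiv_comp_mfderivWithin t h1 h2
      (uniqueDiffOn_Icc (one_pos : (0 : ℝ) < 1) t ht).uniqueMDiffWithinAt
    exact (DFunLike.congr_fun h3 (1 : ℝ)).symm
  have hcC : ContDiffWithinAt ℝ 1 c (Icc 0 1) 0 := by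
    rw [← contMDiffWithinAt_iff_contDiffWithinAt]
    have h1 : ContMDiffAt (𝓡 2) 𝓘(ℝ, EuclideanSpace ℝ (Fin 2)) 1 φ (σ 0) := contMDiffAt_extChartAt
    exact h1.comp_contMDiffWithinAt 0 (hσ 0 h0mem)
  have hc'lim : Filter.Tendsto c' (𝓝[>] 0) (𝓝 (c' 0)) := by
    have h1 : ContinuousWithinAt (fderivWithin ℝ c (Icc 0 1)) (Icc 0 1) 0 :=
      (hcC.fderivWithin_right (m := 0) (uniqueDiffOn_Icc one_pos) (by norm_num)
        h0mem).continuousWithinAt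
    have h2 := (h1.tendsto.mono_left hIcc_le)
    have h3 := ChartMetric.tendsto_clm_apply h2 (tendsto_const_nhds (x := (1 : ℝ)))
    rw [hc'eq 0 h0mem hxs]
    refine h3.congr' ?_
    filter_upwards [hsrc, hIoo] with t ht1 ht2 using (hc'eq t (Ioo_subset_Icc_self ht2) ht1).symm
  have hcd : ∀ᶠ t in 𝓝[>] (0 : ℝ), HasDerivAt c (c' t) t := by
    filter_upwards [hsrc, hIoo] with t ht1 ht2
    have h1 : MDifferentiableAt (𝓡 2) 𝓘(ℝ, EuclideanSpace ℝ (Fin 2)) φ (σ t) :=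
      mdifferentiableAt_extChartAt (by rwa [← extChartAt_source (I := 𝓡 2)])
    have h2 : MDifferentiableWithinAt 𝓘(ℝ, ℝ) (𝓡 2) σ (Icc 0 1) t :=
      (hσ t (Ioo_subset_Icc_self ht2)).mdifferentiableWithinAt (by simp)
    have h3 : DifferentiableWithinAt ℝ c (Icc 0 1) t :=
      (h1.comp_mdifferentiableWithinAt t h2).differentiableWithinAt
    rw [hc'eq t (Ioo_subset_Icc_self ht2) ht1]
    have h4 : HasDerivWithinAt c (fderivWithin ℝ c (Icc 0 1) t 1) (Icc 0 1) t :=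
      h3.hasFDerivWithinAt.hasDerivWithinAt
    exact h4.hasDerivAt (Icc_mem_nhds ht2.1 ht2.2)
  have hc0 : Filter.Tendsto c (𝓝[>] 0) (𝓝 (c 0)) :=
    (continuousAt_extChartAt x₀).tendsto.comp hσc
  set W : ℝ → EuclideanSpace ℝ (Fin 2) := fun t =>
    mfderiv (𝓡 2) 𝓘(ℝ, EuclideanSpace ℝ (Fin 2)) φ (σ t) (T.field (σ t)) with hWdef
  have hW : Filter.Tendsto W (𝓝[>] 0) (𝓝 (W 0)) :=
    (continuousAt_mfderiv_extChartAt T.continuous x₀).tendsto.comp hσc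
  set N' : ℝ → EuclideanSpace ℝ (Fin 2) := fun t =>
    mfderiv (𝓡 2) 𝓘(ℝ, EuclideanSpace ℝ (Fin 2)) φ (σ t) (N t) with hN'def
  have hinner : ∀ t, σ t ∈ φ.source → ∀ v w : TangentSpace (𝓡 2) (σ t),
      G (c t) (mfderiv (𝓡 2) 𝓘(ℝ, EuclideanSpace ℝ (Fin 2)) φ (σ t) v)
        (mfderiv (𝓡 2) 𝓘(ℝ, EuclideanSpace ℝ (Fin 2)) φ (σ t) w) = g.inner (σ t) v w :=
    fun t ht v w => metricInChart_mfderiv ht v w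
  have hφs : φ.symm (c 0) = x₀ := φ.left_inv hxs
  refine ChartMetric.false_of_null_deriv_pos (c := c) (c' := c') (N := N') (W := W) (G := G)
    (ρ := ρ) (k := Module.finrank ℝ (EuclideanSpace ℝ (Fin n)) - 1) (n₀ := N' 0) hE
    (g.isMetricAt x₀ (φ.map_source hxs))
    (contDiffAt_comp_extChartAt_symm hr x₀ (φ.map_source hxs)) (hr_pos _) ?_ hc0 hc'lim hcd hW
    ((hinner 0 hxs _ _).trans_lt (T.timelike _)) ((hinner 0 hxs _ _).trans_lt (hN 0 h0mem).2.2)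
    ((hinner 0 hxs _ _).trans (hN 0 h0mem).2.1)
    ((hσ_spacelike 0 h0mem).trans_eq (hinner 0 hxs _ _).symm)
    ((hσN 0 h0mem).trans_eq (hinner 0 hxs _ _).symm)
    ((dirDeriv_eq_fderiv hr hxs (N 0)).symm.trans hN_zero) ?_
  · filter_upwards [(isOpen_extChartAt_target x₀).mem_nhds (φ.map_source hxs)] with y hy
    intro u l hu hl hul
    have hx : φ.symm y ∈ φ.source := φ.map_target hy
    obtain ⟨A, hA, hAG, hAr, hAh⟩ := hess_metricInChart g hr hx
    rw [← hφ, φ.right_inv hy] at hAG hAr hAh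
    obtain ⟨u, rfl⟩ := hA u
    obtain ⟨l, rfl⟩ := hA l
    rw [← hAG] at hu hl hul
    have key := hess_le_of_dominantEnergyCondition g hE hE' hr hr_pos hdec hh hf
      (φ.symm y) hu hl hul
    rwa [hAh, hAh, hAr, hAr] at key
  · filter_upwards [hsrc, hIoo] with t ht1 ht2
    have ht := Ioo_subset_Icc_self ht2
    exact ⟨(hinner t ht1 _ _).trans (hN t ht).2.1, (hinner t ht1 _ _).trans_lt (hN t ht).2.2,
      (hσN t ht).trans_eq (hinner t ht1 _ _).symm,
      (hN_pos t (Ioo_subset_Ioc_self ht2)).trans_eq (dirDeriv_eq_fderiv hr ht1 (N t))⟩
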